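/- Let $\lambda>-1/2$. Let $C_n^\lambda$ be the Gegenbauer polynomials: $C_0^\lambda=1$, $C_1^\lambda(t)=2\lambda t$, $nC_n^\lambda(t)=2t(n+\lambda-1)C_{n-1}^\lambda(t)-(n+2\lambda-2)C_{n-2}^\lambda(t)$ for $n\ge2$, with the convention that $C_n^0:=T_n$ is the Chebyshev polynomial when $\lambda=0$. For $x\in\mathbb R$ put $$R_n^\lambda(x)=(1+x^2)^{-\frac{\lambda+1}2}\,C_n^\lambda\Big(\frac{x}{\sqrt{1+x^2}}\Big),$$ and let $\pi_N^\lambda$ be the $L^2(\mathbb R)$-orthogonal projection onto $\mathrm{span}\{R_0^\lambda,\dots,R_N^\lambda\}$. For $s\ge 0$ let $H^s(\mathbb R)$ be the set of (complex valued) $u\in L^2(\mathbb R)$ with $\|u\|_{H^s(\mathbb R)}=\big(\int_{\mathbb R}(1+|\xi|^2)^s|\mathscr F[u](\xi)|^2\,d\xi\big)^{1/2}<\infty$, where $\mathscr F$ is the unitary Fourier transform on $L^2(\mathbb R)$, $\mathscr F[u](\xi)=\frac1{\sqrt{2\pi}}\int_{\mathbb R}u(x)e^{-\mathrm i x\xi}\,dx$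 for $u\in L^1(\mathbb R)\cap L^2(\mathbb R)$. Put $a(x)=(1+x^2)^{3/2}$, and define, with weak derivatives, $\mathscr D_x^0u=(1+x^2)^{\frac{\lambda+1}2}u$ and $\mathscr D_x^{k+1}u=a\,\frac{d}{dx}\big(\mathscr D_x^{k}u\big)$. (In the variable $t=x/\sqrt{1+x^2}\in(-1,1)$ this is $\mathscr D^k_xu=\frac{d^k}{dt^k}\breve U(t)$ with $\breve U(t)=(1-t^2)^{-\frac{\lambda+1}2}u\big(t/\sqrt{1-t^2}\big)$.) For an integer $m\ge1$ let $\mathbb B^m_\lambda(\mathbb R)$ be the space of measurable $u$ for which $\mathscr D_x^0u,\dots,\mathscr D_x^mu$ exist and $$\|u\|_{\mathbb B^m_\lambda}=\Big(\sum_{k=0}^m\big\|(1+x^2)^{\sigma}\mathscr D_x^ku\big\|_{L^2(\mathbb R)}^2\Big)^{1/2}<\infty,\qquad |u|_{\mathbb B^m_\lambda}=\big\|(1+x^2)^{\sigma}\mathscr D_x^mu\big\|_{L^2(\mathbb R)},\qquad \sigma=-\frac{\lambda+m+1}2,$$ so that $|u|_{\mathbb B^m_\lambda}^2=\int_{-1}^1\big|\tfrac{d^m}{dt^m}\breve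 U(t)\big|^2(1-t^2)^{\lambda+m-\frac12}\,dt$. **Theorem.** Let $\lambda>-1/2$, $s\in(0,1)$ and let $m\ge1$ be an integer. There is a constant $c>0$, independent of $N$ and $u$, such that for all integers $N\ge1$ with $m\le N+1$ and all $u\in H^s(\mathbb R)\cap\mathbb B^m_\lambda(\mathbb R)$, $$\|\pi_N^\lambda u-u\|_{H^s(\mathbb R)}\le c\,N^{s-m}\,|u|_{\mathbb B^m_\lambda}.$$ The same estimate, with the same $c$, holds when the space $\mathbb B^m_\lambda(\mathbb R)$ and its seminorm are defined with the exponent $\sigma=\frac14-\frac{\lambda+m}2$ instead. -/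

import Mathlib

open MeasureTheory FourierTransform
open scoped ENNReal ContDiff

namespace MMGF

noncomputable section

/-- The space `L²(ℝ)` of (classes of) square integrable complex valued functions. -/
abbrev L2 : Type := Lp ℂ 2 (volume : Measure ℝ)

/-! ### Gegenbauer polynomials and the modified mapped Gegenbauer functions -/

/-- The sequence given by `C₀ = 1`, `C₁ = 2 λ t` and
`n Cₙ = 2 t (n + λ - 1) Cₙ₋₁ - (n + 2 λ - 2) Cₙ₋₂` for `n ≥ 2`. -/
def gegenbauerRec (lam : ℝ) : ℕ → Polynomial ℝ
  | 0 => 1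
  | 1 => Polynomial.C (2 * lam) * Polynomial.X
  | (n + 2) => Polynomial.C (1 / ((n : ℝ) + 2)) *
      (Polynomial.C (2 * ((n : ℝ) + 2 + lam - 1)) * Polynomial.X * gegenbauerRec lam (n + 1)
        - Polynomial.C ((n : ℝ) + 2 + 2 * lam - 2) * gegenbauerRec lam n)

/-- The Gegenbauer polynomial `C_n^λ`, with the usual convention that `C_n^0` is the Chebyshev
polynomial `T_n` (the recurrence itself degenerates at `λ = 0`). -/
def gegenbauer (lam : ℝ) (n : ℕ) : Polynomial ℝ :=
  if lam = 0 then Polynomial.Chebyshev.T ℝ n else gegenbauerRec lam n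

/-- `R_n^λ(x) = (1 + x²)^{-(λ+1)/2} C_n^λ(x / √(1 + x²))`. -/
def mmgf (lam : ℝ) (n : ℕ) (x : ℝ) : ℝ :=
  (1 + x ^ 2) ^ (-((lam + 1) / 2)) * (gegenbauer lam n).eval (x / √(1 + x ^ 2))

theorem continuous_mmgf (lam : ℝ) (n : ℕ) : Continuous (mmgf lam n) := by
  have h : ∀ x : ℝ, 0 < 1 + x ^ 2 := fun x => by positivity
  unfold mmgf
  refine Continuous.mul ?_ ?_
  · exact (by fun_prop : Continuous fun x : ℝ => 1 + x ^ 2).rpow_const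
      fun x => Or.inl (h x).ne'
  · refine (Polynomial.continuous _).comp ?_
    exact continuous_id.div (by fun_prop) fun x => (Real.sqrt_pos.2 (h x)).ne'

theorem memLp_mmgf {lam : ℝ} (hlam : -1 / 2 < lam) (n : ℕ) :
    MemLp (fun x => (mmgf lam n x : ℂ)) 2 (volume : Measure ℝ) := by
  obtain ⟨M, hM⟩ := (isCompact_Icc (a := (-1 : ℝ)) (b := 1)).exists_bound_of_continuousOn
    (gegenbauer lam n).continuous.continuousOn
  have hpos : ∀ x : ℝ, 0 < 1 + x ^ 2 := fun x => by positivity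
  have hbase : MemLp (fun x : ℝ => M * (1 + x ^ 2) ^ (-((lam + 1) / 2))) 2 volume := by
    refine MemLp.const_mul ?_ M
    have hc : Continuous fun x : ℝ => (1 + x ^ 2) ^ (-((lam + 1) / 2)) :=
      (by fun_prop : Continuous fun x : ℝ => 1 + x ^ 2).rpow_const
        fun x => Or.inl (hpos x).ne'
    rw [memLp_two_iff_integrable_sq hc.aestronglyMeasurable]
    have := integrable_rpow_neg_one_add_norm_sq (E := ℝ) (μ := volume) (r := 2 * (lam + 1))
      (by simp; linarith)
    refine this.congr (Filter.Eventually.of_forall fun x => ?_)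
    simp only [Real.norm_eq_abs, sq_abs]
    rw [← Real.rpow_natCast (_ ^ (-((lam + 1) / 2))) 2, ← Real.rpow_mul (hpos x).le]
    congr 1
    push_cast
    ring
  refine hbase.mono
    (Complex.continuous_ofReal.comp (continuous_mmgf lam n)).aestronglyMeasurable
    (Filter.Eventually.of_forall fun x => ?_)
  have ht : x / √(1 + x ^ 2) ∈ Set.Icc (-1 : ℝ) 1 := by
    have h1 : |x| ≤ √(1 + x ^ 2) := Real.abs_le_sqrt (by linarith)
    have h2 := Real.sqrt_pos.2 (hpos x)
    rw [Set.mem_Icc, ← abs_le, abs_div, abs_of_pos h2]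
    exact (div_le_one h2).2 h1
  have h3 : ‖(gegenbauer lam n).eval (x / √(1 + x ^ 2))‖ ≤ ‖M‖ :=
    (hM _ ht).trans (Real.le_norm_self M)
  rw [Complex.norm_real, mmgf, norm_mul, norm_mul, mul_comm]
  exact mul_le_mul_of_nonneg_right h3 (norm_nonneg _)

/-- `R_n^λ` as an element of `L²(ℝ)`. -/
def mmgfL2 {lam : ℝ} (hlam : -1 / 2 < lam) (n : ℕ) : L2 := (memLp_mmgf hlam n).toLp

/-- `V_N^λ = span {R_0^λ, …, R_N^λ}`. -/
def approxSpace {lam : ℝ} (hlam : -1 / 2 < lam) (N : ℕ) : Submodule ℂ L2 :=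
  Submodule.span ℂ (Set.range fun n : Fin (N + 1) => mmgfL2 hlam n)

instance {lam : ℝ} (hlam : -1 / 2 < lam) (N : ℕ) :
    FiniteDimensional ℂ (approxSpace hlam N) :=
  FiniteDimensional.span_of_finite ℂ (Set.finite_range _)

/-- `π_N^λ`, the `L²(ℝ)`-orthogonal projection onto `V_N^λ`. -/
def proj {lam : ℝ} (hlam : -1 / 2 < lam) (N : ℕ) : L2 →L[ℂ] L2 :=
  (approxSpace hlam N).starProjection

/-! ### Fractional Sobolev spaces on the line -/

/-- The unitary Fourier transform on `L²(ℝ)`,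
`𝓕[u](ξ) = (2π)^{-1/2} ∫ u(x) e^{-i x ξ} dx` for integrable `u`. Mathlib's `𝓕` has the kernel
`e^{-2π i x ξ}`. -/
def fourierUnitary (u : L2) (ξ : ℝ) : ℂ :=
  ((1 / √(2 * Real.pi) : ℝ) : ℂ) * (𝓕 u : L2) (ξ / (2 * Real.pi))

/-- `‖u‖_{H^s(ℝ)} = (∫ (1 + |ξ|²)^s |𝓕[u](ξ)|² dξ)^{1/2}`, with value `∞` where the integral
diverges. -/
def sobolevNorm (s : ℝ) (u : L2) : ℝ≥0∞ :=
  (∫⁻ ξ : ℝ, ENNReal.ofReal ((1 + |ξ| ^ 2) ^ s) * ‖fourierUnitary u ξ‖ₑ ^ 2) ^ (1 / 2 : ℝ)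

/-- `u ∈ H^s(ℝ)`. -/
def MemSobolev (s : ℝ) (u : L2) : Prop := sobolevNorm s u < ⊤

/-! ### The mapped weighted Sobolev spaces -/

/-- `g` is the weak derivative of `f` on `ℝ`, both locally integrable. -/
def IsWeakDeriv (f g : ℝ → ℂ) : Prop :=
  LocallyIntegrable f ∧ LocallyIntegrable g ∧
    ∀ φ : ℝ → ℝ, ContDiff ℝ ∞ φ → HasCompactSupport φ →
      ∫ x, f x * ((deriv φ x : ℝ) : ℂ) = - ∫ x, g x * ((φ x : ℝ) : ℂ)

/-- `D k = 𝒟_x^k u` for `0 ≤ k ≤ m`: `D 0 = (1 + x²)^{(λ+1)/2} u` and `D (k+1) = a (D k)'` with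
`a(x) = (1 + x²)^{3/2}`, the derivatives being weak ones. The functions `D 0, …, D m`, if they
exist, are determined almost everywhere by `u`. -/
def IsMappedDeriv (lam : ℝ) (m : ℕ) (u : ℝ → ℂ) (D : ℕ → ℝ → ℂ) : Prop :=
  (D 0 =ᵐ[volume] fun x => (((1 + x ^ 2) ^ ((lam + 1) / 2) : ℝ) : ℂ) * u x) ∧
    ∀ k < m, IsWeakDeriv (D k)
      (fun x => (((1 + x ^ 2) ^ (-(3 / 2) : ℝ) : ℝ) : ℂ) * D (k + 1) x)

/-- `‖(1 + x²)^σ f‖_{L²(ℝ)}`. -/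
def weightedNorm (σ : ℝ) (f : ℝ → ℂ) : ℝ≥0∞ :=
  eLpNorm (fun x => (((1 + x ^ 2) ^ σ : ℝ) : ℂ) * f x) 2 volume

/-- `(∑_{k ≤ m} ‖(1 + x²)^σ 𝒟_x^k u‖²)^{1/2}`. As the `𝒟_x^k u` are unique almost everywhere, the
infimum is over at most one value; it is `∞` if they do not exist. -/
def mappedNorm (lam σ : ℝ) (m : ℕ) (u : ℝ → ℂ) : ℝ≥0∞ :=
  ⨅ (D : ℕ → ℝ → ℂ) (_ : IsMappedDeriv lam m u D),
    (∑ k ∈ Finset.range (m + 1), weightedNorm σ (D k) ^ 2) ^ (1 / 2 : ℝ)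

/-- `‖(1 + x²)^σ 𝒟_x^m u‖`, with the same convention on the infimum. -/
def mappedSeminorm (lam σ : ℝ) (m : ℕ) (u : ℝ → ℂ) : ℝ≥0∞ :=
  ⨅ (D : ℕ → ℝ → ℂ) (_ : IsMappedDeriv lam m u D), weightedNorm σ (D m)

/-- `u` is measurable and its norm with the weight `(1 + x²)^σ` is finite. -/
def MemMapped (lam σ : ℝ) (m : ℕ) (u : ℝ → ℂ) : Prop :=
  AEStronglyMeasurable u volume ∧ mappedNorm lam σ m u < ⊤

end

end MMGF

open Filter Topology

namespace MMGF

noncomputable section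

/-! In the variable `t = x / √(1 + x²)`, multiplying by `(1 + x²)^{-α/2}` identifies `L²(ℝ)` with
the `L²` space of the weight `(1 - t²)^{α - 3/2}` on `(-1, 1)`. For `α = λ + 1` this is the
Gegenbauer weight, and `π_N` becomes the orthogonal projection onto the polynomials of degree at
most `N`. Only degrees matter from there on; neither orthogonality nor norms of the Gegenbauer
polynomials are used.

The derivative `d/dt`, from weight `α` to weight `α + 1`, has an adjoint that raises degrees by at
most one (`adjDeriv`). Hence if an error is orthogonal to degrees below `n + 1`, its derivative is
orthogonal to degrees below `n`. The adjoint composed with `d/dt` is triangular on polynomials with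
diagonal entries `n (n + 2α - 2)`, which gives the Poincaré inequality `IsPolyDeriv.poincare`.
Applying it once per derivative (`IsMappedChain.pow_mul_norm_sq_le`) yields an error of order
`N^{-m}`, and of order `N^{1-m}` for its derivative.

Going back to `x`, the weight controls the ordinary derivative of the error
(`IsWeakDeriv.exists_weighted`). Splitting frequencies at height `N`
(`IsWeakDeriv.sobolevNorm_sq_le`) then gives the rate `N^{s-m}` in `H^s`. The analytic groundwork
justifies integration by parts without boundary terms: cutoffs, and a Hardy argument placing every
lower derivative in its weighted `L²` space once the top one is there. -/

theorem one_add_sq_pos (x : ℝ) : 0 < 1 + x ^ 2 := by positivity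

theorem one_le_one_add_sq (x : ℝ) : 1 ≤ 1 + x ^ 2 := by nlinarith [sq_nonneg x]

theorem contDiff_one_add_sq_rpow (β : ℝ) : ContDiff ℝ ∞ fun x : ℝ => (1 + x ^ 2) ^ β :=
  ContDiff.rpow_const_of_ne (by fun_prop) fun x => (one_add_sq_pos x).ne'

theorem continuous_one_add_sq_rpow (β : ℝ) : Continuous fun x : ℝ => (1 + x ^ 2) ^ β :=
  (contDiff_one_add_sq_rpow β).continuous

theorem hasDerivAt_one_add_sq_rpow (β x : ℝ) :
    HasDerivAt (fun x : ℝ => (1 + x ^ 2) ^ β) (2 * β * x * (1 + x ^ 2) ^ (β - 1)) x := by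
  have h : HasDerivAt (fun x : ℝ => 1 + x ^ 2) (2 * x) x := by
    simpa using ((hasDerivAt_id x).pow 2).const_add 1
  convert! h.rpow_const (p := β) (Or.inl (one_add_sq_pos x).ne') using 1
  ring

/-! ### Cutoffs and the calculus of weak derivatives. -/

/-- Smooth cutoffs `χ (x / (n + 1))`, whose derivatives decay like `(1 + x²)^{-1/2}` uniformly
in `n`. -/
theorem exists_cutoff : ∃ (C : ℝ) (χ : ℕ → ℝ → ℝ), (∀ n, ContDiff ℝ ∞ (χ n)) ∧
    (∀ n, HasCompactSupport (χ n)) ∧ (∀ n x, |χ n x| ≤ 1) ∧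
    (∀ x, Tendsto (fun n => χ n x) atTop (𝓝 1)) ∧
    (∀ x, Tendsto (fun n => deriv (χ n) x) atTop (𝓝 0)) ∧
    ∀ n x, |deriv (χ n) x| ≤ C * (1 + x ^ 2) ^ (-(1 / 2) : ℝ) := by
  let b : ContDiffBump (0 : ℝ) := ⟨1, 2, one_pos, one_lt_two⟩
  have hb : ContDiff ℝ ∞ b := b.contDiff
  have hbd : Differentiable ℝ b := hb.differentiable (by simp)
  have hc : Continuous (deriv b) := hb.continuous_deriv (by simp)
  -- The constant is a bound for `b'(y) √(1 + y²)`. It survives the scaling because `√(1 + x²) ≤ (n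
  -- + 1) √(1 + (x / (n + 1))²)`.
  have hs : HasCompactSupport (fun y : ℝ => deriv b y * √(1 + y ^ 2)) :=
    (b.hasCompactSupport.deriv).mul_right
  obtain ⟨C, hC⟩ := hs.exists_bound_of_continuous (hc.mul (by fun_prop))
  have hd : ∀ (n : ℕ) (x : ℝ), deriv (fun x => b (x / (n + 1))) x
      = deriv b (x / (n + 1)) / (n + 1) := fun n x => by
    have := (hbd (x / (n + 1))).hasDerivAt.comp x ((hasDerivAt_id x).div_const ((n : ℝ) + 1))
    rw [show (fun x => b (x / (n + 1))) = b ∘ fun x => id x / ((n : ℝ) + 1) from rfl, this.deriv]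
    simp [div_eq_mul_inv]
  have hbound : ∀ (n : ℕ) (x : ℝ), |deriv b (x / (n + 1)) / (n + 1)| * √(1 + x ^ 2) ≤ C := by
    intro n x
    have h1 := hC (x / (n + 1))
    have hn : (1 : ℝ) ≤ n + 1 := by simp
    have hn0 : (0 : ℝ) < n + 1 := by positivity
    have h2 : √(1 + x ^ 2) ≤ √(1 + (x / (n + 1)) ^ 2) * (n + 1) := by
      rw [Real.sqrt_le_left (by positivity), mul_pow, Real.sq_sqrt (by positivity), div_pow]
      field_simp
      nlinarith
    rw [Real.norm_eq_abs, abs_mul, abs_of_nonneg (Real.sqrt_nonneg _)] at h1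
    rw [abs_div, abs_of_pos hn0]
    calc _ ≤ |deriv b (x / (n + 1))| / (n + 1) * (√(1 + (x / (n + 1)) ^ 2) * (n + 1)) := by gcongr
      _ = |deriv b (x / (n + 1))| * √(1 + (x / (n + 1)) ^ 2) := by field_simp
      _ ≤ C := h1
  have hlim : ∀ x : ℝ, Tendsto (fun n : ℕ => x / ((n : ℝ) + 1)) atTop (𝓝 0) := fun x =>
    (tendsto_natCast_atTop_atTop.atTop_add tendsto_const_nhds).const_div_atTop x
  refine ⟨C, fun n x => b (x / (n + 1)), fun n => hb.comp (by fun_prop), fun n => ?_, fun n x => ?_,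
    fun x => ?_, fun x => ?_, fun n x => ?_⟩
  · have := b.hasCompactSupport.comp_homeomorph
      (Homeomorph.mulRight₀ ((n : ℝ) + 1)⁻¹ (by positivity))
    simpa [Function.comp_def, div_eq_mul_inv] using this
  · rw [abs_of_nonneg b.nonneg]
    exact b.le_one
  · have := (hb.continuous.tendsto 0).comp (hlim x)
    rwa [b.one_of_mem_closedBall (by simp [b])] at this
  · simp only [hd]
    have := ((hc.tendsto 0).comp (hlim x)).mul
      (tendsto_one_div_add_atTop_nhds_zero_nat (𝕜 := ℝ))
    rw [mul_zero] at this
    simpa [div_eq_mul_inv] using this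
  · rw [hd, Real.rpow_neg (one_add_sq_pos x).le, ← Real.sqrt_eq_rpow, ← div_eq_mul_inv,
      le_div_iff₀ (Real.sqrt_pos.2 (one_add_sq_pos x))]
    exact hbound n x

theorem _root_.MeasureTheory.LocallyIntegrable.integrable_mul_of_hasCompactSupport {f : ℝ → ℂ}
    (hf : LocallyIntegrable f) {φ : ℝ → ℝ} (hφ : Continuous φ) (hc : HasCompactSupport φ) :
    Integrable fun x => f x * (φ x : ℂ) := by
  have := hf.integrable_smul_left_of_hasCompactSupport hφ hc
  refine this.congr (.of_forall fun x => ?_)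
  simp [mul_comm]

theorem _root_.MeasureTheory.LocallyIntegrable.ofReal_continuous_mul {f : ℝ → ℂ}
    (hf : LocallyIntegrable f) {φ : ℝ → ℝ} (hφ : Continuous φ) :
    LocallyIntegrable fun x => (φ x : ℂ) * f x := by
  exact (hf.mul_continuous (Complex.continuous_ofReal.comp hφ)).congr
    (.of_forall fun x => by simp [mul_comm])

namespace IsWeakDeriv

variable {f g : ℝ → ℂ}

/-- Integration by parts against a smooth function without compact support. -/
theorem integral_eq_real (h : IsWeakDeriv f g) {φ : ℝ → ℝ} (hφ : ContDiff ℝ ∞ φ)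
    (h1 : Integrable fun x => f x * ((deriv φ x : ℝ) : ℂ))
    (h2 : Integrable fun x => g x * (φ x : ℂ))
    (h3 : Integrable fun x => f x * (φ x : ℂ) * (((1 + x ^ 2) ^ (-(1 / 2) : ℝ) : ℝ) : ℂ)) :
    ∫ x, f x * ((deriv φ x : ℝ) : ℂ) = - ∫ x, g x * (φ x : ℂ) := by
  obtain ⟨C, χ, hs, hc, hb, hl, hdl, hdb⟩ := exists_cutoff
  have hφd : Differentiable ℝ φ := hφ.differentiable (by simp)
  have hχd : ∀ n, Differentiable ℝ (χ n) := fun n => (hs n).differentiable (by simp)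
  have hprod : ∀ n x, deriv (fun x => φ x * χ n x) x
      = deriv φ x * χ n x + φ x * deriv (χ n) x := fun n x =>
    ((hφd x).hasDerivAt.mul (hχd n x).hasDerivAt).deriv
  have key : ∀ n, ∫ x, f x * ((deriv φ x * χ n x + φ x * deriv (χ n) x : ℝ) : ℂ)
      = - ∫ x, g x * ((φ x * χ n x : ℝ) : ℂ) := fun n => by
    have := h.2.2 (fun x => φ x * χ n x) (hφ.mul (hs n)) (hc n).mul_left
    simpa only [hprod] using this
  have hfm := h.1.aestronglyMeasurable
  have hgm := h.2.1.aestronglyMeasurable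
  have hφ'c : Continuous (deriv φ) := hφ.continuous_deriv (by simp)
  have hm : ∀ {ψ : ℝ → ℝ}, Continuous ψ → AEStronglyMeasurable (fun x => (ψ x : ℂ)) volume :=
    fun hψ => (Complex.continuous_ofReal.comp hψ).aestronglyMeasurable
  refine tendsto_nhds_unique (f := fun n => ∫ x, f x *
    ((deriv φ x * χ n x + φ x * deriv (χ n) x : ℝ) : ℂ)) (l := atTop) ?_ ?_
  -- The term in which the cutoff is differentiated is dominated by `C` times the integrand of `h3`;
  -- this is what the decay `(1 + x²)^{-1/2}` is for.
  · refine tendsto_integral_of_dominated_convergence (fun x => ‖f x * ((deriv φ x : ℝ) : ℂ)‖ +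
      C * ‖f x * (φ x : ℂ) * (((1 + x ^ 2) ^ (-(1 / 2) : ℝ) : ℝ) : ℂ)‖) (fun n => ?_)
      (h1.norm.add (h3.norm.const_mul C)) (fun n => .of_forall fun x => ?_)
      (.of_forall fun x => ?_)
    · exact hfm.mul (hm ((hφ'c.mul (hs n).continuous).add
        (hφ.continuous.mul ((hs n).continuous_deriv (by simp)))))
    · push_cast
      rw [mul_add]
      refine (norm_add_le _ _).trans (add_le_add ?_ ?_)
      · rw [← mul_assoc, norm_mul, Complex.norm_real (χ n x)]
        exact mul_le_of_le_one_right (norm_nonneg _) (hb n x)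
      · rw [← mul_assoc, norm_mul, norm_mul (f x * _), Complex.norm_real (deriv (χ n) x),
          Complex.norm_real ((1 + x ^ 2) ^ (-(1 / 2) : ℝ)), mul_left_comm]
        refine mul_le_mul_of_nonneg_left ?_ (norm_nonneg _)
        rw [Real.norm_of_nonneg (Real.rpow_nonneg (one_add_sq_pos x).le _)]
        exact hdb n x
    · have : Tendsto (fun n => deriv φ x * χ n x + φ x * deriv (χ n) x) atTop
          (𝓝 (deriv φ x)) := by
        simpa using ((hl x).const_mul (deriv φ x)).add ((hdl x).const_mul (φ x))
      exact ((Complex.continuous_ofReal.tendsto _).comp this).const_mul (f x)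
  · simp only [key]
    refine (tendsto_integral_of_dominated_convergence (fun x => ‖g x * (φ x : ℂ)‖) (fun n => ?_)
      h2.norm (fun n => .of_forall fun x => ?_) (.of_forall fun x => ?_)).neg
    · exact hgm.mul (hm (hφ.continuous.mul (hs n).continuous))
    · push_cast
      rw [← mul_assoc, norm_mul, Complex.norm_real (χ n x)]
      exact mul_le_of_le_one_right (norm_nonneg _) (hb n x)
    · have : Tendsto (fun n => φ x * χ n x) atTop (𝓝 (φ x)) := by
        simpa using (hl x).const_mul (φ x)
      exact ((Complex.continuous_ofReal.tendsto _).comp this).const_mul (g x)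

/-- Weak derivatives are tested against real functions, so the real and imaginary parts of `φ` are
treated separately. Taking either part does not increase absolute values, so integrability passes to
both. -/
theorem integral_eq (h : IsWeakDeriv f g) {φ φ' : ℝ → ℂ} (hφ : ContDiff ℝ ∞ φ)
    (hφ' : ∀ x, HasDerivAt φ (φ' x) x)
    (h1 : Integrable fun x => f x * φ' x)
    (h2 : Integrable fun x => g x * φ x)
    (h3 : Integrable fun x => f x * φ x * (((1 + x ^ 2) ^ (-(1 / 2) : ℝ) : ℝ) : ℂ)) :
    ∫ x, f x * φ' x = - ∫ x, g x * φ x := by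
  have hfm := h.1.aestronglyMeasurable
  have hgm := h.2.1.aestronglyMeasurable
  have hφ'c : Continuous φ' := by
    rw [show φ' = deriv φ from funext fun x => (hφ' x).deriv.symm]
    exact hφ.continuous_deriv (by simp)
  have hm : ∀ {ψ : ℝ → ℝ}, Continuous ψ → AEStronglyMeasurable (fun x => (ψ x : ℂ)) volume :=
    fun hψ => (Complex.continuous_ofReal.comp hψ).aestronglyMeasurable
  have hw := hm (continuous_one_add_sq_rpow (-(1 / 2)))
  have part : ∀ T : ℂ →L[ℝ] ℝ, (∀ z, |T z| ≤ ‖z‖) →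
      Integrable (fun x => f x * ((T (φ' x) : ℝ) : ℂ)) ∧
      Integrable (fun x => g x * ((T (φ x) : ℝ) : ℂ)) ∧
      ∫ x, f x * ((T (φ' x) : ℝ) : ℂ) = - ∫ x, g x * ((T (φ x) : ℝ) : ℂ) := by
    intro T hT
    have hT' : ∀ x, HasDerivAt (fun x => T (φ x)) (T (φ' x)) x := fun x =>
      (T.hasFDerivAt (x := φ x)).comp_hasDerivAt x (hφ' x)
    have hd : deriv (fun x => T (φ x)) = fun x => T (φ' x) := funext fun x => (hT' x).deriv
    have hle : ∀ a z : ℂ, ‖a * ((T z : ℝ) : ℂ)‖ ≤ ‖a * z‖ := fun a z => by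
      rw [norm_mul, norm_mul, Complex.norm_real]
      exact mul_le_mul_of_nonneg_left (hT z) (norm_nonneg _)
    have i1 : Integrable (fun x => f x * ((T (φ' x) : ℝ) : ℂ)) :=
      h1.mono (hfm.mul (hm (T.continuous.comp hφ'c))) (.of_forall fun x => hle _ _)
    have i2 : Integrable (fun x => g x * ((T (φ x) : ℝ) : ℂ)) :=
      h2.mono (hgm.mul (hm (T.continuous.comp hφ.continuous))) (.of_forall fun x => hle _ _)
    refine ⟨i1, i2, ?_⟩
    have i3 : Integrable (fun x => f x * ((T (φ x) : ℝ) : ℂ) *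
        (((1 + x ^ 2) ^ (-(1 / 2) : ℝ) : ℝ) : ℂ)) := by
      refine h3.mono ((hfm.mul (hm (T.continuous.comp hφ.continuous))).mul hw)
        (.of_forall fun x => ?_)
      rw [norm_mul, norm_mul (f x * φ x)]
      exact mul_le_mul_of_nonneg_right (hle _ _) (norm_nonneg _)
    have := h.integral_eq_real (φ := fun x => T (φ x)) (T.contDiff.comp hφ) (by simpa [hd] using i1)
      i2 i3
    simpa only [hd] using this
  obtain ⟨a1, a2, a3⟩ := part Complex.reCLM fun z => Complex.abs_re_le_norm z
  obtain ⟨b1, b2, b3⟩ := part Complex.imCLM fun z => Complex.abs_im_le_norm z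
  have e : ∀ a z : ℂ, a * z = a * ((Complex.reCLM z : ℝ) : ℂ)
      + (a * ((Complex.imCLM z : ℝ) : ℂ)) * Complex.I := fun a z => by
    conv_lhs => rw [← Complex.re_add_im z, mul_add]
    simp [mul_assoc]
  calc ∫ x, f x * φ' x = _ := integral_congr_ae (.of_forall fun x => e _ _)
    _ = - ((∫ x, g x * ((Complex.reCLM (φ x) : ℝ) : ℂ)) +
        ∫ x, g x * ((Complex.imCLM (φ x) : ℝ) : ℂ) * Complex.I) := by
      rw [integral_add a1 (b1.mul_const _), a3, integral_mul_const, b3, integral_mul_const]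
      ring
    _ = _ := by
      rw [← integral_add a2 (b2.mul_const _)]
      congr 1
      exact integral_congr_ae (.of_forall fun x => (e _ _).symm)

/-- The product rule. -/
theorem mul (h : IsWeakDeriv f g) {ψ : ℝ → ℝ} (hψ : ContDiff ℝ ∞ ψ) :
    IsWeakDeriv (fun x => (ψ x : ℂ) * f x)
      (fun x => (ψ x : ℂ) * g x + ((deriv ψ x : ℝ) : ℂ) * f x) := by
  have hψ' : Continuous (deriv ψ) := hψ.continuous_deriv (by simp)
  have hψd : Differentiable ℝ ψ := hψ.differentiable (by simp)
  refine ⟨h.1.ofReal_continuous_mul hψ.continuous,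
    (h.2.1.ofReal_continuous_mul hψ.continuous).add (h.1.ofReal_continuous_mul hψ'), fun φ hφ hc => ?_⟩
  have hφd : Differentiable ℝ φ := hφ.differentiable (by simp)
  have hd : deriv (fun x => ψ x * φ x) = fun x => deriv ψ x * φ x + ψ x * deriv φ x :=
    funext fun x => ((hψd x).hasDerivAt.mul (hφd x).hasDerivAt).deriv
  have key := h.2.2 (fun x => ψ x * φ x) (hψ.mul hφ) hc.mul_left
  rw [hd] at key
  have hφ' : Continuous (deriv φ) := hφ.continuous_deriv (by simp)
  have i1 := h.1.integrable_mul_of_hasCompactSupport (φ := fun x => deriv ψ x * φ x)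
    (hψ'.mul hφ.continuous) hc.mul_left
  have i2 := h.1.integrable_mul_of_hasCompactSupport (φ := fun x => ψ x * deriv φ x)
    (hψ.continuous.mul hφ') hc.deriv.mul_left
  have i3 := h.2.1.integrable_mul_of_hasCompactSupport (φ := fun x => ψ x * φ x)
    (hψ.continuous.mul hφ.continuous) hc.mul_left
  have e1 : ∫ x, f x * ((deriv ψ x * φ x + ψ x * deriv φ x : ℝ) : ℂ)
      = (∫ x, f x * ((deriv ψ x * φ x : ℝ) : ℂ)) + ∫ x, f x * ((ψ x * deriv φ x : ℝ) : ℂ) := by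
    rw [← integral_add i1 i2]
    exact integral_congr_ae (.of_forall fun x => by push_cast; ring)
  have e2 : ∫ x, ((ψ x : ℂ) * g x + ((deriv ψ x : ℝ) : ℂ) * f x) * ((φ x : ℝ) : ℂ)
      = (∫ x, g x * ((ψ x * φ x : ℝ) : ℂ)) + ∫ x, f x * ((deriv ψ x * φ x : ℝ) : ℂ) := by
    rw [← integral_add i3 i1]
    exact integral_congr_ae (.of_forall fun x => by push_cast; ring)
  have e3 : ∫ x, (ψ x : ℂ) * f x * ((deriv φ x : ℝ) : ℂ)
      = ∫ x, f x * ((ψ x * deriv φ x : ℝ) : ℂ) :=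
    integral_congr_ae (.of_forall fun x => by push_cast; ring)
  rw [e2, e3]
  rw [e1] at key
  linear_combination key

theorem sub {f₂ g₂ : ℝ → ℂ} (h : IsWeakDeriv f g) (h₂ : IsWeakDeriv f₂ g₂) :
    IsWeakDeriv (fun x => f x - f₂ x) (fun x => g x - g₂ x) := by
  refine ⟨h.1.sub h₂.1, h.2.1.sub h₂.2.1, fun φ hφ hc => ?_⟩
  have hφ' : Continuous (deriv φ) := hφ.continuous_deriv (by simp)
  simp only [sub_mul]
  rw [integral_sub (h.1.integrable_mul_of_hasCompactSupport hφ' hc.deriv)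
      (h₂.1.integrable_mul_of_hasCompactSupport hφ' hc.deriv),
    integral_sub (h.2.1.integrable_mul_of_hasCompactSupport hφ.continuous hc)
      (h₂.2.1.integrable_mul_of_hasCompactSupport hφ.continuous hc), h.2.2 φ hφ hc,
    h₂.2.2 φ hφ hc]
  ring

/-- A classical derivative is a weak derivative. -/
theorem of_hasDerivAt (hg : Continuous g) (h : ∀ x, HasDerivAt f (g x) x) : IsWeakDeriv f g := by
  have hf : Continuous f := continuous_iff_continuousAt.2 fun x => (h x).continuousAt
  refine ⟨hf.locallyIntegrable, hg.locallyIntegrable, fun φ hφ hc => ?_⟩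
  have hφ' : Continuous (deriv φ) := hφ.continuous_deriv (by simp)
  have hφd : ∀ x, HasDerivAt (fun x => (φ x : ℂ)) ((deriv φ x : ℝ) : ℂ) x := fun x =>
    ((hφ.differentiable (by simp)) x).hasDerivAt.ofReal_comp
  exact integral_mul_deriv_eq_deriv_mul_of_integrable (fun x _ => h x) (fun x _ => hφd x)
    (hf.locallyIntegrable.integrable_mul_of_hasCompactSupport hφ' hc.deriv)
    (hg.locallyIntegrable.integrable_mul_of_hasCompactSupport hφ.continuous hc)
    (hf.locallyIntegrable.integrable_mul_of_hasCompactSupport hφ.continuous hc)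

theorem congr_left {f₂ : ℝ → ℂ} (h : IsWeakDeriv f g) (hf : f =ᵐ[volume] f₂) :
    IsWeakDeriv f₂ g := by
  refine ⟨h.1.congr hf, h.2.1, fun φ hφ hc => ?_⟩
  rw [← h.2.2 φ hφ hc]
  exact integral_congr_ae (hf.mono fun x hx => by simp only [hx])

end IsWeakDeriv

/-! ### Weighted integrability, primitives and a Hardy argument. -/

theorem integrable_one_add_sq_rpow {α : ℝ} (hα : 1 / 2 < α) :
    Integrable fun x : ℝ => (1 + x ^ 2) ^ (-α) := by
  have := integrable_rpow_neg_one_add_norm_sq (E := ℝ) (μ := volume) (r := 2 * α)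
    (by simp; linarith)
  refine this.congr (.of_forall fun x => ?_)
  simp only [Real.norm_eq_abs, sq_abs]
  congr 1
  ring

theorem memLp_one_add_sq_rpow {α : ℝ} (hα : 1 / 2 < α) :
    MemLp (fun x : ℝ => (1 + x ^ 2) ^ (-(α / 2))) 2 volume := by
  rw [memLp_two_iff_integrable_sq (continuous_one_add_sq_rpow _).aestronglyMeasurable]
  refine (integrable_one_add_sq_rpow hα).congr (.of_forall fun x => ?_)
  dsimp only
  rw [← Real.rpow_natCast (_ ^ (-(α / 2))) 2, ← Real.rpow_mul (one_add_sq_pos x).le]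
  congr 1
  push_cast
  ring

theorem exists_support_subset_Ioc {φ : ℝ → ℝ} (hc : HasCompactSupport φ) :
    ∃ R : ℝ, 0 < R ∧ Function.support φ ⊆ Set.Ioc (-R) R := by
  obtain ⟨R, hR0, hR⟩ := hc.isCompact.isBounded.subset_ball_lt 0 0
  refine ⟨R, hR0, fun x hx => ?_⟩
  have := hR (subset_tsupport φ hx)
  rw [Real.ball_eq_Ioo, zero_sub, zero_add] at this
  exact ⟨this.1, this.2.le⟩

theorem _root_.MeasureTheory.LocallyIntegrable.intervalIntegrable_real {E : Type*}
    [NormedAddCommGroup E] {g : ℝ → E} (hg : LocallyIntegrable g) (a b : ℝ) :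
    IntervalIntegrable g volume a b :=
  intervalIntegrable_iff.2 ((hg.integrableOn_isCompact isCompact_uIcc).mono_set
    Set.uIoc_subset_uIcc)

/-- A primitive is absolutely continuous on compact intervals, so it can be integrated by parts
there, and Lebesgue differentiation identifies its derivative almost everywhere. -/
theorem integral_primitive_mul_deriv_real {g : ℝ → ℝ} (hg : LocallyIntegrable g) {φ : ℝ → ℝ}
    (hφ : ContDiff ℝ ∞ φ) (hc : HasCompactSupport φ) :
    ∫ x, (∫ t in (0 : ℝ)..x, g t) * deriv φ x = - ∫ x, g x * φ x := by
  obtain ⟨R, hR0, hR⟩ := exists_support_subset_Ioc (φ := fun x => |φ x| + |deriv φ x|)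
    ((hc.comp_left (g := fun y => |y|) abs_zero).add
      (hc.deriv.comp_left (g := fun y => |y|) abs_zero))
  have hz : ∀ x, x ∉ Set.Ioc (-R) R → φ x = 0 ∧ deriv φ x = 0 := fun x hx => by
    have : |φ x| + |deriv φ x| = 0 := by
      by_contra h
      exact hx (hR h)
    constructor <;> rw [← abs_eq_zero] <;> linarith [abs_nonneg (φ x), abs_nonneg (deriv φ x)]
  rw [← intervalIntegral.integral_eq_integral_of_support_subset (a := -R) (b := R)
      fun x hx => by_contra fun h => hx (by simp [(hz x h).2]),
    ← intervalIntegral.integral_eq_integral_of_support_subset (a := -R) (b := R)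
      fun x hx => by_contra fun h => hx (by simp [(hz x h).1])]
  have hgi : IntervalIntegrable g volume (-R) R := (hg.intervalIntegrable_real _ _)
  have h0 : (0 : ℝ) ∈ Set.uIcc (-R) R := by
    rw [Set.uIcc_of_le (by linarith)]
    constructor <;> linarith
  rw [AbsolutelyContinuousOnInterval.integral_mul_deriv_eq_deriv_mul
    (hgi.absolutelyContinuousOnInterval_intervalIntegral h0)
    ((hφ.of_le (by simp)).contDiffOn.absolutelyContinuousOnInterval),
    (hz (-R) (by simp)).1]
  -- The half-open interval contains its right endpoint, so vanishing there comes from continuity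
  -- from the right.
  have hcR : φ R = 0 := by
    have hcont : Tendsto φ (𝓝[>] R) (𝓝 (φ R)) := hφ.continuous.continuousWithinAt
    refine tendsto_nhds_unique hcont (tendsto_const_nhds.congr' ?_)
    filter_upwards [self_mem_nhdsWithin] with x hx
    exact (hz x fun h => absurd h.2 (not_le.2 hx)).1.symm
  rw [hcR, mul_zero, mul_zero, sub_zero, zero_sub]
  congr 1
  refine intervalIntegral.integral_congr_ae ?_
  filter_upwards [LocallyIntegrable.ae_hasDerivAt_integral hg] with x hx _
  rw [(hx 0).deriv]

/-- The primitive of a locally integrable function has it as weak derivative. -/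
theorem isWeakDeriv_primitive {g : ℝ → ℂ} (hg : LocallyIntegrable g) :
    IsWeakDeriv (fun x => ∫ t in (0 : ℝ)..x, g t) g := by
  have hG : Continuous fun x => ∫ t in (0 : ℝ)..x, g t :=
    intervalIntegral.continuous_primitive (fun _ _ => (hg.intervalIntegrable_real _ _)) 0
  refine ⟨hG.locallyIntegrable, hg, fun φ hφ hc => ?_⟩
  have hφ' : Continuous (deriv φ) := hφ.continuous_deriv (by simp)
  have i1 := hG.locallyIntegrable.integrable_mul_of_hasCompactSupport hφ' hc.deriv
  have i2 := hg.integrable_mul_of_hasCompactSupport hφ.continuous hc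
  have part : ∀ T : ℂ →L[ℝ] ℝ, (∀ (z : ℂ) (r : ℝ), T (z * r) = T z * r) →
      T (∫ x, (∫ t in (0 : ℝ)..x, g t) * ((deriv φ x : ℝ) : ℂ))
        = T (- ∫ x, g x * ((φ x : ℝ) : ℂ)) := fun T hT => by
    have hTg : LocallyIntegrable fun x => T (g x) := fun x => by
      obtain ⟨U, hU, hi⟩ := hg x
      exact ⟨U, hU, T.integrable_comp hi⟩
    rw [map_neg, ← T.integral_comp_comm i1, ← T.integral_comp_comm i2]
    simp only [hT]
    rw [← integral_primitive_mul_deriv_real hTg hφ hc]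
    refine integral_congr_ae (.of_forall fun x => ?_)
    dsimp only
    rw [T.intervalIntegral_comp_comm (hg.intervalIntegrable_real _ _)]
  exact Complex.ext (part Complex.reCLM fun z r => by simp) (part Complex.imCLM fun z r => by simp)

/-- The du Bois-Reymond lemma. -/
theorem ae_eq_const_of_integral_mul_deriv_eq_zero {h : ℝ → ℂ} (hh : LocallyIntegrable h)
    (H : ∀ φ : ℝ → ℝ, ContDiff ℝ ∞ φ → HasCompactSupport φ →
      ∫ x, h x * ((deriv φ x : ℝ) : ℂ) = 0) :
    ∃ c : ℂ, h =ᵐ[volume] fun _ => c := by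
  let b : ContDiffBump (0 : ℝ) := ⟨1, 2, one_pos, one_lt_two⟩
  set ρ := b.normed volume with hρdef
  have hρ : ContDiff ℝ ∞ ρ := b.contDiff_normed
  have hρc : HasCompactSupport ρ := b.hasCompactSupport_normed
  have hρ1 : ∫ x, ρ x = 1 := b.integral_normed
  refine ⟨∫ x, h x * (ρ x : ℂ), ?_⟩
  set c := ∫ x, h x * (ρ x : ℂ) with hcdef
  have key : ∀ᵐ x : ℝ, h x - c = 0 := by
    refine ae_eq_zero_of_integral_contDiff_smul_eq_zero
      (hh.sub (locallyIntegrable_const c)) fun ψ hψ hψc => ?_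
    have hψi : Integrable ψ := hψ.continuous.integrable_of_hasCompactSupport hψc
    have hρi : Integrable ρ := hρ.continuous.integrable_of_hasCompactSupport hρc
    set I := ∫ x, ψ x with hI
    -- Subtracting a multiple of the bump of integral one makes the integral vanish, so `θ` is the
    -- derivative of a compactly supported test function.
    let θ : ℝ → ℝ := fun x => ψ x - I * ρ x
    have hθ : ContDiff ℝ ∞ θ := hψ.sub (contDiff_const.mul hρ)
    have hθc : HasCompactSupport θ := hψc.sub hρc.mul_left
    have hθ0 : ∫ x, θ x = 0 := by
      simp only [θ]
      rw [integral_sub hψi (hρi.const_mul I), integral_const_mul, hρ1, ← hI]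
      ring
    obtain ⟨R, hR0, hR⟩ := exists_support_subset_Ioc hθc
    have hz : ∀ x, x ∉ Set.Ioc (-R) R → θ x = 0 := fun x hx => by
      by_contra h
      exact hx (hR h)
    let φ : ℝ → ℝ := fun x => ∫ t in (-R)..x, θ t
    have hφ' : ∀ x, HasDerivAt φ (θ x) x := fun x =>
      intervalIntegral.integral_hasDerivAt_right (hθ.continuous.intervalIntegrable _ _)
        (hθ.continuous.stronglyMeasurableAtFilter _ _) hθ.continuous.continuousAt
    have hd : deriv φ = θ := funext fun x => (hφ' x).deriv
    have hφ : ContDiff ℝ ∞ φ := by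
      rw [contDiff_infty_iff_deriv, hd]
      exact ⟨fun x => (hφ' x).differentiableAt, hθ⟩
    have hφc : HasCompactSupport φ := by
      refine HasCompactSupport.of_support_subset_isCompact (isCompact_Icc (a := -R) (b := R))
        fun x hx => ?_
      by_contra hxn
      apply hx
      rw [Set.mem_Icc, not_and_or, not_le, not_le] at hxn
      rcases hxn with hxn | hxn
      · refine intervalIntegral.integral_zero_ae (.of_forall fun t ht => hz t ?_)
        rw [Set.uIoc_of_ge hxn.le] at ht
        exact fun h => absurd h.1 (not_lt.2 ht.2)
      · simp only [φ]
        rw [intervalIntegral.integral_eq_integral_of_support_subset, hθ0]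
        exact hR.trans (Set.Ioc_subset_Ioc_right hxn.le)
    have h0 := H φ hφ hφc
    rw [hd] at h0
    have j1 := hh.integrable_mul_of_hasCompactSupport hψ.continuous hψc
    have j2 := hh.integrable_mul_of_hasCompactSupport hρ.continuous hρc
    have j3 : Integrable fun x => (ψ x : ℂ) * c := hψi.ofReal.mul_const c
    have e1 : ∫ x, h x * ((θ x : ℝ) : ℂ) = (∫ x, h x * (ψ x : ℂ)) - I * c := by
      rw [hcdef, ← integral_const_mul, ← integral_sub j1 (j2.const_mul _)]
      exact integral_congr_ae (.of_forall fun x => by simp only [θ]; push_cast; ring)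
    have e2 : ∫ x, ψ x • (h x - c) = (∫ x, h x * (ψ x : ℂ)) - I * c := by
      rw [hI, ← integral_complex_ofReal, ← integral_mul_const,
        ← integral_sub j1 j3]
      exact integral_congr_ae (.of_forall fun x => by
        simp only [Complex.real_smul]; ring)
    have e3 : ∫ x, ψ x • (h x - c) = 0 := by rw [e2, ← e1, h0]
    exact e3
  filter_upwards [key] with x hx using sub_eq_zero.1 hx

theorem IsWeakDeriv.exists_ae_eq_primitive {f g : ℝ → ℂ} (h : IsWeakDeriv f g) :
    ∃ c : ℂ, f =ᵐ[volume] fun x => c + ∫ t in (0 : ℝ)..x, g t := by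
  have h' := h.sub (isWeakDeriv_primitive h.2.1)
  obtain ⟨c, hc⟩ := ae_eq_const_of_integral_mul_deriv_eq_zero h'.1 fun φ hφ hφc => by
    rw [h'.2.2 φ hφ hφc]
    simp
  exact ⟨c, by filter_upwards [hc] with x hx using by rw [← hx]; ring⟩

/-- With `a` the weighted, square integrable `G`, the integrand is `(1 + t²)^{(α-2)/2} a`. For `|t|
≤ |x|` the power is at most `(1 + x²)^{β/2} (1 + t²)^{-1/2}` with `β = max (α - 1) 0`. The product
of the last factor with `|a|` is bounded by the sum of their squares, which is integrable. -/
theorem norm_integral_le_of_weighted {α : ℝ} {G : ℝ → ℂ}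
    (hG : MemLp (fun x => (((1 + x ^ 2) ^ (-((α + 1) / 2)) : ℝ) : ℂ) * G x) 2 volume) :
    ∃ K : ℝ, 0 ≤ K ∧ ∀ x : ℝ, ‖∫ t in (0 : ℝ)..x, (((1 + t ^ 2) ^ (-(3 / 2) : ℝ) : ℝ) : ℂ) * G t‖
      ≤ K * (1 + x ^ 2) ^ (max (α - 1) 0 / 2) := by
  set β := max (α - 1) 0 with hβ
  have hβ0 : 0 ≤ β := le_max_right _ _
  have hβα : α - 1 ≤ β := le_max_left _ _
  set a : ℝ → ℂ := fun x => (((1 + x ^ 2) ^ (-((α + 1) / 2)) : ℝ) : ℂ) * G x with ha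
  have i1 : Integrable fun t => ‖a t‖ ^ 2 := (memLp_two_iff_integrable_sq_norm hG.1).1 hG
  have i2 : Integrable fun t : ℝ => (1 + t ^ 2) ^ (-1 : ℝ) :=
    integrable_one_add_sq_rpow (by norm_num)
  refine ⟨∫ t, (‖a t‖ ^ 2 + (1 + t ^ 2) ^ (-1 : ℝ)),
    integral_nonneg fun t => by have := one_add_sq_pos t; positivity, fun x => ?_⟩
  have hpt : ∀ t ∈ Set.uIoc 0 x, ‖(((1 + t ^ 2) ^ (-(3 / 2) : ℝ) : ℝ) : ℂ) * G t‖
      ≤ (1 + x ^ 2) ^ (β / 2) * (‖a t‖ ^ 2 + (1 + t ^ 2) ^ (-1 : ℝ)) := by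
    intro t ht
    have hwt := one_add_sq_pos t
    have hwx := one_add_sq_pos x
    have hsq : t ^ 2 ≤ x ^ 2 := by
      rw [sq_le_sq]
      have := Set.abs_sub_left_of_mem_uIcc (Set.uIoc_subset_uIcc ht)
      simpa using this
    have e : (((1 + t ^ 2) ^ (-(3 / 2) : ℝ) : ℝ) : ℂ) * G t
        = (((1 + t ^ 2) ^ ((α - 2) / 2) : ℝ) : ℂ) * a t := by
      rw [ha, ← mul_assoc, ← Complex.ofReal_mul, ← Real.rpow_add hwt]
      congr 3
      ring
    rw [e, norm_mul, Complex.norm_real, Real.norm_of_nonneg (Real.rpow_nonneg hwt.le _)]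
    have h1 : (1 + t ^ 2) ^ ((α - 2) / 2) ≤ (1 + x ^ 2) ^ (β / 2) * (1 + t ^ 2) ^ (-(1 / 2) : ℝ) :=
      calc (1 + t ^ 2) ^ ((α - 2) / 2) ≤ (1 + t ^ 2) ^ (β / 2 + -(1 / 2)) :=
            Real.rpow_le_rpow_of_exponent_le (one_le_one_add_sq t) (by linarith)
        _ = (1 + t ^ 2) ^ (β / 2) * (1 + t ^ 2) ^ (-(1 / 2) : ℝ) := Real.rpow_add hwt _ _
        _ ≤ _ := by
          gcongr
    have h2 : (1 + t ^ 2) ^ (-1 : ℝ) = ((1 + t ^ 2) ^ (-(1 / 2) : ℝ)) ^ 2 := by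
      rw [← Real.rpow_natCast (_ ^ (-(1 / 2) : ℝ)) 2, ← Real.rpow_mul hwt.le]
      norm_num
    rw [h2]
    have hX : 0 ≤ (1 + x ^ 2) ^ (β / 2) := by positivity
    calc _ ≤ (1 + x ^ 2) ^ (β / 2) * (1 + t ^ 2) ^ (-(1 / 2) : ℝ) * ‖a t‖ := by gcongr
      _ = (1 + x ^ 2) ^ (β / 2) * ((1 + t ^ 2) ^ (-(1 / 2) : ℝ) * ‖a t‖) := by ring
      _ ≤ _ := by
        gcongr
        nlinarith [sq_nonneg ((1 + t ^ 2) ^ (-(1 / 2) : ℝ) - ‖a t‖), sq_nonneg ‖a t‖,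
          sq_nonneg ((1 + t ^ 2) ^ (-(1 / 2) : ℝ))]
  have hint := (i1.add i2).const_mul ((1 + x ^ 2) ^ (β / 2))
  rw [intervalIntegral.norm_integral_eq_norm_integral_uIoc]
  refine (norm_integral_le_of_norm_le hint.integrableOn
    ((ae_restrict_iff' measurableSet_uIoc).2 (.of_forall hpt))).trans ?_
  refine (setIntegral_le_integral hint (.of_forall fun t => ?_)).trans (le_of_eq ?_)
  · have := one_add_sq_pos t
    have := one_add_sq_pos x
    simp only [Pi.zero_apply, Pi.add_apply]
    positivity
  · simp only [Pi.add_apply]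
    rw [integral_const_mul, mul_comm]

/-- A Hardy type inequality in qualitative form. -/
theorem IsWeakDeriv.memLp_weighted {α : ℝ} (hα : 1 / 2 < α) {F G : ℝ → ℂ}
    (h : IsWeakDeriv F fun x => (((1 + x ^ 2) ^ (-(3 / 2) : ℝ) : ℝ) : ℂ) * G x)
    (hG : MemLp (fun x => (((1 + x ^ 2) ^ (-((α + 1) / 2)) : ℝ) : ℂ) * G x) 2 volume) :
    MemLp (fun x => (((1 + x ^ 2) ^ (-(α / 2)) : ℝ) : ℂ) * F x) 2 volume := by
  obtain ⟨c, hc⟩ := h.exists_ae_eq_primitive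
  obtain ⟨K, hK0, hK⟩ := norm_integral_le_of_weighted hG
  -- The growth of the primitive leaves the exponent `α - max (α - 1) 0 = min 1 α`, still above
  -- `1/2`.
  have hbase := (memLp_one_add_sq_rpow (α := min 1 α) (lt_min (by norm_num) hα)).const_mul
    (‖c‖ + K)
  refine hbase.mono' (((Complex.continuous_ofReal.comp
    (continuous_one_add_sq_rpow _)).aestronglyMeasurable).mul h.1.aestronglyMeasurable) ?_
  filter_upwards [hc] with x hx
  have hw := one_add_sq_pos x
  have h1 : (1 : ℝ) ≤ (1 + x ^ 2) ^ (max (α - 1) 0 / 2) :=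
    Real.one_le_rpow (one_le_one_add_sq x) (by positivity)
  have h2 : ‖F x‖ ≤ (‖c‖ + K) * (1 + x ^ 2) ^ (max (α - 1) 0 / 2) := by
    rw [hx, add_mul]
    exact (norm_add_le _ _).trans
      (add_le_add (le_mul_of_one_le_right (norm_nonneg _) h1) (hK x))
  rw [norm_mul, Complex.norm_real, Real.norm_of_nonneg (Real.rpow_nonneg hw.le _)]
  calc _ ≤ (1 + x ^ 2) ^ (-(α / 2)) * ((‖c‖ + K) * (1 + x ^ 2) ^ (max (α - 1) 0 / 2)) := by
        gcongr
    _ = (‖c‖ + K) * ((1 + x ^ 2) ^ (-(α / 2)) * (1 + x ^ 2) ^ (max (α - 1) 0 / 2)) := by ring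
    _ = _ := by
      rw [← Real.rpow_add hw]
      congr 2
      rcases le_total α 1 with h | h
      · rw [max_eq_right (by linarith), min_eq_right h]
        ring
      · rw [max_eq_left (by linarith), min_eq_left h]
        ring

/-! ### The variable `t` and weighted polynomials. -/

/-- The map `x ↦ x / √(1 + x²)` from the line onto `(-1, 1)`. -/
def mapT (x : ℝ) : ℝ := x / √(1 + x ^ 2)

theorem mapT_eq (x : ℝ) : mapT x = x * (1 + x ^ 2) ^ (-(1 / 2) : ℝ) := by
  rw [mapT, Real.sqrt_eq_rpow, Real.rpow_neg (one_add_sq_pos x).le, div_eq_mul_inv]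

theorem mapT_mul_rpow (x β : ℝ) : mapT x * (1 + x ^ 2) ^ β = x * (1 + x ^ 2) ^ (β - 1 / 2) := by
  rw [mapT_eq, mul_assoc, ← Real.rpow_add (one_add_sq_pos x)]
  congr 2
  ring

theorem one_sub_mapT_sq (x : ℝ) : 1 - mapT x ^ 2 = (1 + x ^ 2)⁻¹ := by
  have := one_add_sq_pos x
  rw [mapT, div_pow, Real.sq_sqrt this.le]
  field_simp
  ring

theorem contDiff_mapT : ContDiff ℝ ∞ mapT := by
  rw [funext mapT_eq]
  exact contDiff_id.mul (contDiff_one_add_sq_rpow _)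

theorem continuous_mapT : Continuous mapT := contDiff_mapT.continuous

theorem hasDerivAt_mapT (x : ℝ) : HasDerivAt mapT ((1 + x ^ 2) ^ (-(3 / 2) : ℝ)) x := by
  rw [funext mapT_eq]
  convert! (hasDerivAt_id x).mul (hasDerivAt_one_add_sq_rpow (-(1 / 2)) x) using 1
  have := one_add_sq_pos x
  have e : (1 + x ^ 2) ^ (-(1 / 2) : ℝ) = (1 + x ^ 2) * (1 + x ^ 2) ^ (-(3 / 2) : ℝ) := by
    rw [← Real.rpow_one_add' this.le (by norm_num)]
    norm_num
  have e2 : (-(1 / 2) : ℝ) - 1 = -(3 / 2) := by norm_num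
  rw [e2, e, id]
  ring

theorem mapT_mem_Icc (x : ℝ) : mapT x ∈ Set.Icc (-1 : ℝ) 1 := by
  have := one_sub_mapT_sq x
  have h2 : 0 < (1 + x ^ 2)⁻¹ := inv_pos.2 (one_add_sq_pos x)
  constructor <;> nlinarith

/-- `(1 + x²)^{-α/2} q(x / √(1 + x²))`. -/
def polyFun (α : ℝ) (q : Polynomial ℂ) (x : ℝ) : ℂ :=
  (((1 + x ^ 2) ^ (-(α / 2)) : ℝ) : ℂ) * q.eval (mapT x : ℂ)

theorem contDiff_eval_mapT (q : Polynomial ℂ) :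
    ContDiff ℝ ∞ fun x : ℝ => q.eval (mapT x : ℂ) := by
  have h : ContDiff ℂ ∞ fun z : ℂ => q.eval z := by
    simpa using q.contDiff_aeval (𝕜 := ℂ) ∞
  exact (h.restrict_scalars ℝ).comp (Complex.ofRealCLM.contDiff.comp contDiff_mapT)

theorem hasDerivAt_eval_mapT (q : Polynomial ℂ) (x : ℝ) :
    HasDerivAt (fun x : ℝ => q.eval (mapT x : ℂ))
      ((((1 + x ^ 2) ^ (-(3 / 2) : ℝ) : ℝ) : ℂ) * q.derivative.eval (mapT x : ℂ)) x := by
  rw [mul_comm]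
  exact HasDerivAt.comp x (q.hasDerivAt (mapT x : ℂ)) (hasDerivAt_mapT x).ofReal_comp

theorem continuous_polyFun (α : ℝ) (q : Polynomial ℂ) : Continuous (polyFun α q) :=
  (Complex.continuous_ofReal.comp (continuous_one_add_sq_rpow _)).mul
    (contDiff_eval_mapT q).continuous

theorem memLp_polyFun {α : ℝ} (hα : 1 / 2 < α) (q : Polynomial ℂ) :
    MemLp (polyFun α q) 2 volume := by
  obtain ⟨M, hM⟩ := (isCompact_Icc (a := (-1 : ℝ)) (b := 1)).exists_bound_of_continuousOn
    (q.continuous.comp Complex.continuous_ofReal).continuousOn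
  refine ((memLp_one_add_sq_rpow hα).const_mul M).mono'
    (continuous_polyFun α q).aestronglyMeasurable (.of_forall fun x => ?_)
  rw [polyFun, norm_mul, Complex.norm_real,
    Real.norm_of_nonneg (Real.rpow_nonneg (one_add_sq_pos x).le _), mul_comm]
  exact mul_le_mul_of_nonneg_right (hM _ (mapT_mem_Icc x))
    (Real.rpow_nonneg (one_add_sq_pos x).le _)

/-- The polynomial `q` as the element `(1 + x²)^{-α/2} q(x / √(1 + x²))` of `L²(ℝ)`. -/
def polyL2 {α : ℝ} (hα : 1 / 2 < α) : Polynomial ℂ →ₗ[ℂ] L2 where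
  toFun q := (memLp_polyFun hα q).toLp
  map_add' p q := by
    rw [← MemLp.toLp_add]
    refine MemLp.toLp_congr _ _ (.of_forall fun x => ?_)
    simp [polyFun, mul_add]
  map_smul' c q := by
    rw [RingHom.id_apply, ← MemLp.toLp_const_smul]
    refine MemLp.toLp_congr _ _ (.of_forall fun x => ?_)
    simp [polyFun]
    ring

theorem coeFn_polyL2 {α : ℝ} (hα : 1 / 2 < α) (q : Polynomial ℂ) :
    polyL2 hα q =ᵐ[volume] polyFun α q := (memLp_polyFun hα q).coeFn_toLp

theorem conj_polyFun (α : ℝ) (q : Polynomial ℂ) (x : ℝ) :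
    starRingEnd ℂ (polyFun α q x) = polyFun α (q.map (starRingEnd ℂ)) x := by
  rw [polyFun, polyFun, map_mul, Complex.conj_ofReal, Polynomial.eval_map,
    ← Polynomial.eval₂_at_apply, Complex.conj_ofReal]

theorem inner_polyL2 {α : ℝ} (hα : 1 / 2 < α) (q : Polynomial ℂ) (f : L2) :
    inner ℂ (polyL2 hα q) f = ∫ x, f x * polyFun α (q.map (starRingEnd ℂ)) x := by
  rw [L2.inner_def]
  refine integral_congr_ae ?_
  filter_upwards [coeFn_polyL2 hα q] with x hx
  rw [hx, RCLike.inner_apply, conj_polyFun]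

/-! ### The adjoint of `d/dt` and integration by parts. -/

/-- The adjoint of `d/dt` on polynomials, for the weights of `polyL2 α` and `polyL2 (α + 1)`. -/
def adjDeriv (α : ℝ) : Polynomial ℂ →ₗ[ℂ] Polynomial ℂ :=
  LinearMap.mulLeft ℂ (Polynomial.C ((2 * α - 1 : ℝ) : ℂ) * Polynomial.X)
    - LinearMap.mulLeft ℂ (1 - Polynomial.X ^ 2) ∘ₗ Polynomial.derivative

theorem adjDeriv_apply (α : ℝ) (q : Polynomial ℂ) :
    adjDeriv α q = Polynomial.C ((2 * α - 1 : ℝ) : ℂ) * Polynomial.X * q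
      - (1 - Polynomial.X ^ 2) * Polynomial.derivative q := rfl

theorem adjDeriv_map_conj (α : ℝ) (q : Polynomial ℂ) :
    adjDeriv α (q.map (starRingEnd ℂ)) = (adjDeriv α q).map (starRingEnd ℂ) := by
  rw [adjDeriv_apply, adjDeriv_apply, Polynomial.derivative_map, Polynomial.map_sub,
    Polynomial.map_mul, Polynomial.map_mul, Polynomial.map_mul, Polynomial.map_C,
    Complex.conj_ofReal]
  simp

/-- In `t` the function is `(1 - t²)^{α - 1/2} q(t)`, the density of weight `α + 1` times `q`.
Differentiating it in `t` gives minus the density of weight `α` times `adjDeriv α q`. -/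
theorem hasDerivAt_polyFun (α : ℝ) (q : Polynomial ℂ) (x : ℝ) :
    HasDerivAt (polyFun (2 * α - 1) q)
      (-((((1 + x ^ 2) ^ (-α) : ℝ) : ℂ) * (adjDeriv α q).eval (mapT x : ℂ))) x := by
  have h1 := (hasDerivAt_one_add_sq_rpow (-((2 * α - 1) / 2)) x).ofReal_comp
  convert! h1.mul (hasDerivAt_eval_mapT q x) using 1
  have hw := one_add_sq_pos x
  have e1 : 2 * -((2 * α - 1) / 2) * x * (1 + x ^ 2) ^ (-((2 * α - 1) / 2) - 1)
      = -(2 * α - 1) * mapT x * (1 + x ^ 2) ^ (-α) := by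
    rw [mul_assoc (-(2 * α - 1)), mapT_mul_rpow]
    ring_nf
  have e2 : (1 + x ^ 2) ^ (-((2 * α - 1) / 2)) * (1 + x ^ 2) ^ (-(3 / 2) : ℝ)
      = (1 - mapT x ^ 2) * (1 + x ^ 2) ^ (-α) := by
    rw [one_sub_mapT_sq, ← Real.rpow_neg_one, ← Real.rpow_add hw, ← Real.rpow_add hw]
    ring_nf
  rw [e1, ← mul_assoc, ← Complex.ofReal_mul, e2, adjDeriv_apply]
  simp
  ring

theorem contDiff_polyFun (α : ℝ) (q : Polynomial ℂ) : ContDiff ℝ ∞ (polyFun α q) :=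
  (Complex.ofRealCLM.contDiff.comp (contDiff_one_add_sq_rpow _)).mul (contDiff_eval_mapT q)

theorem isWeakDeriv_eval_mapT (q : Polynomial ℂ) :
    IsWeakDeriv (fun x : ℝ => q.eval (mapT x : ℂ))
      (fun x => (((1 + x ^ 2) ^ (-(3 / 2) : ℝ) : ℝ) : ℂ) * q.derivative.eval (mapT x : ℂ)) :=
  .of_hasDerivAt ((Complex.continuous_ofReal.comp (continuous_one_add_sq_rpow _)).mul
    (contDiff_eval_mapT _).continuous) (hasDerivAt_eval_mapT q)

/-- Integration by parts in the variable `t`. -/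
theorem IsWeakDeriv.inner_polyL2_eq {α : ℝ} (hα : 1 / 2 < α) (hα' : 1 / 2 < α + 1) {F G : ℝ → ℂ}
    (h : IsWeakDeriv F fun x => (((1 + x ^ 2) ^ (-(3 / 2) : ℝ) : ℝ) : ℂ) * G x)
    (hF : MemLp (fun x => (((1 + x ^ 2) ^ (-(α / 2)) : ℝ) : ℂ) * F x) 2 volume)
    (hG : MemLp (fun x => (((1 + x ^ 2) ^ (-((α + 1) / 2)) : ℝ) : ℂ) * G x) 2 volume)
    (q : Polynomial ℂ) :
    inner ℂ (polyL2 hα' q) (hG.toLp : L2) = inner ℂ (polyL2 hα (adjDeriv α q)) (hF.toLp : L2) := by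
  rw [inner_polyL2, inner_polyL2, ← adjDeriv_map_conj]
  set p := q.map (starRingEnd ℂ)
  have hw : ∀ {x β γ δ : ℝ}, β + γ = δ → ((((1 + x ^ 2) ^ β : ℝ) : ℂ)) * (((1 + x ^ 2) ^ γ : ℝ) : ℂ)
      = (((1 + x ^ 2) ^ δ : ℝ) : ℂ) := fun {x β γ δ} h => by
    rw [← h, Real.rpow_add (one_add_sq_pos x), Complex.ofReal_mul]
  have e1 : (fun x => F x * -((((1 + x ^ 2) ^ (-α) : ℝ) : ℂ) * (adjDeriv α p).eval (mapT x : ℂ)))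
      = fun x => -(((((1 + x ^ 2) ^ (-(α / 2)) : ℝ) : ℂ) * F x) * polyFun α (adjDeriv α p) x) := by
    funext x
    rw [polyFun, ← hw (x := x) (show -(α / 2) + -(α / 2) = -α by ring)]
    ring
  have e2 : (fun x => (((1 + x ^ 2) ^ (-(3 / 2) : ℝ) : ℝ) : ℂ) * G x * polyFun (2 * α - 1) p x)
      = fun x => ((((1 + x ^ 2) ^ (-((α + 1) / 2)) : ℝ) : ℂ) * G x) * polyFun (α + 1) p x := by
    funext x
    rw [polyFun, polyFun]
    have : (((1 + x ^ 2) ^ (-(3 / 2) : ℝ) : ℝ) : ℂ) * (((1 + x ^ 2) ^ (-((2 * α - 1) / 2)) : ℝ) : ℂ)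
        = (((1 + x ^ 2) ^ (-((α + 1) / 2)) : ℝ) : ℂ) * (((1 + x ^ 2) ^ (-((α + 1) / 2)) : ℝ) : ℂ) := by
      rw [hw rfl, hw rfl]
      ring_nf
    linear_combination G x * p.eval (mapT x : ℂ) * this
  have e3 : (fun x => F x * polyFun (2 * α - 1) p x * (((1 + x ^ 2) ^ (-(1 / 2) : ℝ) : ℝ) : ℂ))
      = fun x => ((((1 + x ^ 2) ^ (-(α / 2)) : ℝ) : ℂ) * F x) * polyFun α p x := by
    funext x
    rw [polyFun, polyFun]
    have : (((1 + x ^ 2) ^ (-((2 * α - 1) / 2)) : ℝ) : ℂ) * (((1 + x ^ 2) ^ (-(1 / 2) : ℝ) : ℝ) : ℂ)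
        = (((1 + x ^ 2) ^ (-(α / 2)) : ℝ) : ℂ) * (((1 + x ^ 2) ^ (-(α / 2)) : ℝ) : ℂ) := by
      rw [hw rfl, hw rfl]
      ring_nf
    linear_combination F x * p.eval (mapT x : ℂ) * this
  -- Each integrability condition is met by a product of two `L²` functions: the weight `α` is
  -- shared evenly in the first and third, the weight `α + 1` in the second.
  have key := h.integral_eq (contDiff_polyFun _ p) (hasDerivAt_polyFun α p)
    (by rw [e1]; exact (hF.integrable_mul (memLp_polyFun hα _)).neg)
    (by rw [e2]; exact hG.integrable_mul (memLp_polyFun hα' _))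
    (by rw [e3]; exact hF.integrable_mul (memLp_polyFun hα _))
  rw [e1, e2, integral_neg, neg_inj] at key
  rw [integral_congr_ae (g := fun x => ((((1 + x ^ 2) ^ (-((α + 1) / 2)) : ℝ) : ℂ) * G x) *
      polyFun (α + 1) p x) (hG.coeFn_toLp.mono fun x hx => by simp only [hx]), ← key]
  exact (integral_congr_ae (hF.coeFn_toLp.mono fun x hx => by simp only [hx])).symm

/-! ### Density of the weighted polynomials. -/

/-- A compactly supported continuous function on the line is a continuous function of
`x / √(1 + x²)`. -/
theorem exists_continuous_comp_mapT {ψ : ℝ → ℝ} (hψ : Continuous ψ) (hc : HasCompactSupport ψ) :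
    ∃ φ : ℝ → ℝ, Continuous φ ∧ ∀ x, φ (mapT x) = ψ x := by
  obtain ⟨a, ha0, ha⟩ := hc.isCompact.isBounded.subset_ball_lt 0 0
  have hz : ∀ x, a ^ 2 ≤ x ^ 2 → ψ x = 0 := fun x hx => by
    by_contra h
    have := ha (subset_tsupport ψ h)
    rw [mem_ball_zero_iff, Real.norm_eq_abs, ← abs_of_pos ha0, ← sq_lt_sq] at this
    linarith
  have hδ : 0 < (1 + a ^ 2)⁻¹ := by positivity
  have hm : ∀ t : ℝ, 0 < max (1 - t ^ 2) (1 + a ^ 2)⁻¹ := fun t => lt_max_of_lt_right hδ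
  -- The inverse map `t / √(1 - t²)` is singular at `±1`. The floor on `1 - t²` removes the
  -- singularity and acts only where `|x| ≥ a`; there the altered argument still has absolute value
  -- at least `a`, so `ψ` vanishes.
  refine ⟨fun t => ψ (t / √(max (1 - t ^ 2) (1 + a ^ 2)⁻¹)),
    hψ.comp (continuous_id.div (by fun_prop) fun t => (Real.sqrt_pos.2 (hm t)).ne'), fun x => ?_⟩
  have hw := one_add_sq_pos x
  dsimp only
  rw [one_sub_mapT_sq]
  rcases le_total (x ^ 2) (a ^ 2) with h | h
  · rw [max_eq_left (inv_anti₀ hw (by linarith)), mapT, Real.sqrt_inv, div_div,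
      mul_inv_cancel₀ (Real.sqrt_pos.2 hw).ne', div_one]
  · rw [max_eq_right (inv_anti₀ (by positivity) (by linarith)), hz x h]
    refine hz _ ?_
    rw [div_pow, Real.sq_sqrt hδ.le, mapT, div_pow, Real.sq_sqrt hw.le, div_inv_eq_mul,
      div_mul_eq_mul_div, le_div_iff₀ hw]
    nlinarith

/-- The function `f (1 + x²)^{-α/2}` is integrable and annihilates polynomials in `t`. By
Weierstrass approximation on `[-1, 1]` it annihilates continuous functions of `t`, and hence all
test functions on the line. -/
theorem eq_zero_of_forall_inner_polyL2 {α : ℝ} (hα : 1 / 2 < α) {f : L2}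
    (hf : ∀ q, inner ℂ (polyL2 hα q) f = 0) : f = 0 := by
  set H : ℝ → ℂ := fun x => f x * (((1 + x ^ 2) ^ (-(α / 2)) : ℝ) : ℂ) with hH
  have hHi : Integrable H := (Lp.memLp f).integrable_mul (memLp_one_add_sq_rpow hα).ofReal
  have hpoly : ∀ p : Polynomial ℝ, ∫ x, H x * ((p.eval (mapT x) : ℝ) : ℂ) = 0 := fun p => by
    have := hf (p.map Complex.ofRealHom)
    rw [inner_polyL2] at this
    rw [← this]
    refine integral_congr_ae (.of_forall fun x => ?_)
    have e : (p.map Complex.ofRealHom).map (starRingEnd ℂ) = p.map Complex.ofRealHom := by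
      rw [Polynomial.map_map]
      congr 1
      ext r
      simp
    simp only [hH]
    rw [e, polyFun, Polynomial.eval_map,
      show (mapT x : ℂ) = Complex.ofRealHom (mapT x) from rfl, Polynomial.eval₂_at_apply,
      Complex.ofRealHom_eq_coe]
    ring
  have hcont : ∀ φ : ℝ → ℝ, Continuous φ → ∫ x, H x * ((φ (mapT x) : ℝ) : ℂ) = 0 := by
    intro φ hφ
    have hφi : Integrable fun x => H x * ((φ (mapT x) : ℝ) : ℂ) := by
      obtain ⟨M, hM⟩ := (isCompact_Icc (a := (-1 : ℝ)) (b := 1)).exists_bound_of_continuousOn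
        hφ.continuousOn
      refine hHi.mul_bdd (c := M) (Complex.continuous_ofReal.comp
        (hφ.comp continuous_mapT)).aestronglyMeasurable (.of_forall fun x => ?_)
      rw [Complex.norm_real]
      exact hM _ (mapT_mem_Icc x)
    have hbound : ∀ ε > 0, ‖∫ x, H x * ((φ (mapT x) : ℝ) : ℂ)‖ ≤ ε * ∫ x, ‖H x‖ := by
      intro ε hε
      obtain ⟨p, hp⟩ := exists_polynomial_near_of_continuousOn (-1) 1 φ hφ.continuousOn ε hε
      have hle : ∀ x, ‖H x * ((φ (mapT x) : ℝ) : ℂ) - H x * ((p.eval (mapT x) : ℝ) : ℂ)‖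
          ≤ ε * ‖H x‖ := fun x => by
        rw [← mul_sub, ← Complex.ofReal_sub, norm_mul, Complex.norm_real, mul_comm ε,
          Real.norm_eq_abs, abs_sub_comm]
        exact mul_le_mul_of_nonneg_left (hp _ (mapT_mem_Icc x)).le (norm_nonneg _)
      have hpi : Integrable fun x => H x * ((p.eval (mapT x) : ℝ) : ℂ) := by
        obtain ⟨M, hM⟩ := (isCompact_Icc (a := (-1 : ℝ)) (b := 1)).exists_bound_of_continuousOn
          p.continuous.continuousOn
        refine hHi.mul_bdd (c := M) (Complex.continuous_ofReal.comp
          (p.continuous.comp continuous_mapT)).aestronglyMeasurable (.of_forall fun x => ?_)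
        rw [Complex.norm_real]
        exact hM _ (mapT_mem_Icc x)
      calc ‖∫ x, H x * ((φ (mapT x) : ℝ) : ℂ)‖
          = ‖∫ x, (H x * ((φ (mapT x) : ℝ) : ℂ) - H x * ((p.eval (mapT x) : ℝ) : ℂ))‖ := by
            rw [integral_sub hφi hpi, hpoly, sub_zero]
        _ ≤ ∫ x, ε * ‖H x‖ :=
            norm_integral_le_of_norm_le (hHi.norm.const_mul ε) (.of_forall hle)
        _ = _ := integral_const_mul _ _
    refine norm_le_zero_iff.1 (le_of_forall_pos_le_add fun ε hε => ?_)
    rw [zero_add]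
    have hI : 0 ≤ ∫ x, ‖H x‖ := integral_nonneg fun _ => norm_nonneg _
    refine (hbound (ε / (1 + ∫ x, ‖H x‖)) (by positivity)).trans ?_
    rw [div_mul_eq_mul_div, div_le_iff₀ (by positivity)]
    nlinarith
  have hzero : ∀ᵐ x, H x = 0 := by
    refine ae_eq_zero_of_integral_contDiff_smul_eq_zero hHi.locallyIntegrable
      fun ψ hψ hψc => ?_
    obtain ⟨φ, hφ, hφψ⟩ := exists_continuous_comp_mapT hψ.continuous hψc
    rw [← hcont φ hφ]
    refine integral_congr_ae (.of_forall fun x => ?_)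
    simp only [hφψ, Complex.real_smul]
    ring
  rw [Lp.eq_zero_iff_ae_eq_zero]
  filter_upwards [hzero] with x hx
  exact (mul_eq_zero.1 hx).resolve_right
    (Complex.ofReal_ne_zero.2 (Real.rpow_pos_of_pos (one_add_sq_pos x) _).ne')

/-! ### Degrees under the adjoint, and the Poincaré inequality. -/

section

open Polynomial

theorem coeff_adjDeriv_zero (α : ℝ) (q : ℂ[X]) : (adjDeriv α q).coeff 0 = -q.coeff 1 := by
  simp [adjDeriv_apply, sub_mul, mul_assoc, coeff_derivative]

theorem coeff_adjDeriv_succ (α : ℝ) (q : ℂ[X]) (k : ℕ) :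
    (adjDeriv α q).coeff (k + 1)
      = (2 * α - 1 + k : ℝ) * q.coeff k - (k + 2) * q.coeff (k + 2) := by
  have h2 : (X ^ 2 * derivative q : ℂ[X]).coeff (k + 1) = k * q.coeff k := by
    rcases k with _ | k
    · rw [pow_two, mul_assoc, coeff_X_mul, coeff_X_mul_zero]
      simp
    · rw [pow_two, mul_assoc, coeff_X_mul, coeff_X_mul, coeff_derivative]
      push_cast
      ring
  rw [adjDeriv_apply, mul_assoc, sub_mul, one_mul, coeff_sub, coeff_sub, h2, coeff_C_mul,
    coeff_X_mul, coeff_derivative]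
  push_cast
  ring

/-- The Gegenbauer operator `-(1 - t²) d²/dt² + (2α - 1) t d/dt` is triangular in the monomials. Its
diagonal entries `k (k + 2α - 2)` become `k (k + 2λ)` for `α = λ + 1`. -/
theorem coeff_adjDeriv_derivative (α : ℝ) (p : ℂ[X]) (k : ℕ) :
    (adjDeriv α (derivative p)).coeff k
      = (k * (k + 2 * α - 2) : ℝ) * p.coeff k - (k + 1) * (k + 2) * p.coeff (k + 2) := by
  rcases k with _ | k
  · rw [coeff_adjDeriv_zero, coeff_derivative]
    push_cast
    ring
  · rw [coeff_adjDeriv_succ, coeff_derivative, coeff_derivative]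
    push_cast
    ring

theorem mem_degreeLT_iff_coeff {n : ℕ} {p : ℂ[X]} :
    p ∈ degreeLT ℂ n ↔ ∀ k, n ≤ k → p.coeff k = 0 := by
  rw [mem_degreeLT, degree_lt_iff_coeff_zero]

theorem adjDeriv_mem_degreeLT (α : ℝ) {n : ℕ} {q : ℂ[X]} (hq : q ∈ degreeLT ℂ n) :
    adjDeriv α q ∈ degreeLT ℂ (n + 1) := by
  rw [mem_degreeLT_iff_coeff] at hq ⊢
  rintro (_ | k) hk
  · omega
  · rw [coeff_adjDeriv_succ, hq k (by omega), hq (k + 2) (by omega)]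
    simp

theorem adjDeriv_derivative_mem_degreeLT (α : ℝ) {n : ℕ} {p : ℂ[X]} (hp : p ∈ degreeLT ℂ n) :
    adjDeriv α (derivative p) ∈ degreeLT ℂ n := by
  rw [mem_degreeLT_iff_coeff] at hp ⊢
  intro k hk
  rw [coeff_adjDeriv_derivative, hp k hk, hp (k + 2) (by omega)]
  simp

theorem adjDeriv_derivative_sub_mem_degreeLT (α : ℝ) {n : ℕ} {p : ℂ[X]}
    (hp : p ∈ degreeLT ℂ (n + 1)) :
    adjDeriv α (derivative p) - ((n * (n + 2 * α - 2) : ℝ) : ℂ) • p ∈ degreeLT ℂ n := by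
  rw [mem_degreeLT_iff_coeff] at hp ⊢
  intro k hk
  rw [coeff_sub, coeff_smul, coeff_adjDeriv_derivative, hp (k + 2) (by omega), smul_eq_mul]
  rcases hk.eq_or_lt with rfl | hk
  · ring
  · rw [hp k (by omega)]
    simp

theorem derivative_mem_degreeLT {n : ℕ} {p : ℂ[X]} (hp : p ∈ degreeLT ℂ (n + 1)) :
    derivative p ∈ degreeLT ℂ n := by
  rw [mem_degreeLT_iff_coeff] at hp ⊢
  intro k hk
  rw [coeff_derivative, hp (k + 1) (by omega), zero_mul]

/-- The image in `L²(ℝ)` of the polynomials of degree less than `n`. -/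
def polySpace {α : ℝ} (hα : 1 / 2 < α) (n : ℕ) : Submodule ℂ L2 :=
  (degreeLT ℂ n).map (polyL2 hα)

instance {α : ℝ} (hα : 1 / 2 < α) (n : ℕ) : FiniteDimensional ℂ (polySpace hα n) := by
  have : FiniteDimensional ℂ (degreeLT ℂ n) :=
    (degreeLTEquiv ℂ n).symm.finiteDimensional
  exact inferInstanceAs (FiniteDimensional ℂ ((degreeLT ℂ n).map (polyL2 hα)))

theorem polySpace_mono {α : ℝ} (hα : 1 / 2 < α) : Monotone (polySpace hα) :=
  fun _ _ h => Submodule.map_mono (degreeLT_mono h)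

theorem polyL2_mem_polySpace {α : ℝ} (hα : 1 / 2 < α) {n : ℕ} {q : ℂ[X]}
    (hq : q ∈ degreeLT ℂ n) : polyL2 hα q ∈ polySpace hα n :=
  Submodule.mem_map_of_mem hq

theorem tendsto_starProjection_polySpace {α : ℝ} (hα : 1 / 2 < α) (f : L2) :
    Tendsto (fun n => (polySpace hα n).starProjection f) atTop (𝓝 f) := by
  refine Submodule.starProjection_tendsto_self _ (polySpace_mono hα) f (top_le_iff.2 ?_)
  rw [Submodule.topologicalClosure_eq_top_iff, Submodule.eq_bot_iff]
  intro g hg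
  refine eq_zero_of_forall_inner_polyL2 hα fun q => hg _ ?_
  refine Submodule.mem_iSup_of_mem (q.natDegree + 1) (polyL2_mem_polySpace hα ?_)
  rw [mem_degreeLT]
  exact degree_le_natDegree.trans_lt (by exact_mod_cast Nat.lt_succ_self _)

/-- `g` is the derivative of `f` with respect to `t`, tested against polynomials. Here `f` and `g`
carry the weights of `polyL2 α` and `polyL2 (α + 1)`. -/
def IsPolyDeriv {α : ℝ} (hα : 1 / 2 < α) (hα' : 1 / 2 < α + 1) (f g : L2) : Prop :=
  ∀ q, inner ℂ (polyL2 hα' q) g = inner ℂ (polyL2 hα (adjDeriv α q)) f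

namespace IsPolyDeriv

variable {α : ℝ} {hα : 1 / 2 < α} {hα' : 1 / 2 < α + 1} {f g : L2}

theorem polyL2 (hα : 1 / 2 < α) (hα' : 1 / 2 < α + 1) (p : ℂ[X]) :
    IsPolyDeriv hα hα' (polyL2 hα p) (MMGF.polyL2 hα' (derivative p)) := fun q =>
  (isWeakDeriv_eval_mapT p).inner_polyL2_eq hα hα' (memLp_polyFun hα p)
    (memLp_polyFun hα' (derivative p)) q

theorem sub {f₂ g₂ : L2} (h : IsPolyDeriv hα hα' f g) (h₂ : IsPolyDeriv hα hα' f₂ g₂) :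
    IsPolyDeriv hα hα' (f - f₂) (g - g₂) := fun q => by
  rw [inner_sub_right, inner_sub_right, h q, h₂ q]

/-- Applied to a projection error, this says that the derivative of the projection is the projection
of the derivative in the next weight, one degree lower. It allows the Poincaré inequality to be
iterated. -/
theorem inner_eq_zero (h : IsPolyDeriv hα hα' f g) {n : ℕ}
    (hf : ∀ q ∈ degreeLT ℂ (n + 1), inner ℂ (MMGF.polyL2 hα q) f = 0) :
    ∀ q ∈ degreeLT ℂ n, inner ℂ (MMGF.polyL2 hα' q) g = 0 := fun q hq => by
  rw [h q]
  exact hf _ (adjDeriv_mem_degreeLT α hq)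

/-- Since `adjDeriv α p'` has degree below `n`, it pairs equally with `f` and with its projection
`p`. Thus `‖p'‖² = ⟨p', g⟩`, and Cauchy-Schwarz concludes. -/
theorem norm_polyL2_derivative_le (h : IsPolyDeriv hα hα' f g) {n : ℕ} {p : ℂ[X]}
    (hp : p ∈ degreeLT ℂ n) (hpf : MMGF.polyL2 hα p = (polySpace hα n).starProjection f) :
    ‖MMGF.polyL2 hα' (derivative p)‖ ≤ ‖g‖ := by
  have e : inner ℂ (MMGF.polyL2 hα' (derivative p)) (MMGF.polyL2 hα' (derivative p))
      = inner ℂ (MMGF.polyL2 hα' (derivative p)) g := by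
    rw [polyL2 hα hα' p, h, hpf, ← Submodule.inner_starProjection_left_eq_right,
      Submodule.starProjection_eq_self_iff.2
        (polyL2_mem_polySpace hα (adjDeriv_derivative_mem_degreeLT α hp))]
  have h1 := norm_inner_le_norm (𝕜 := ℂ) (MMGF.polyL2 hα' (derivative p)) g
  rw [← e, inner_self_eq_norm_sq_to_K, norm_pow, RCLike.norm_ofReal, abs_norm, pow_two] at h1
  rcases (norm_nonneg (MMGF.polyL2 hα' (derivative p))).eq_or_lt with h0 | h0
  · rw [← h0]
    exact norm_nonneg _
  · exact le_of_mul_le_mul_left h1 h0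

/-- Move one derivative over by the adjoint. The cross term pairs `r` with a polynomial of degree
below `n` and vanishes; in `‖r'‖²` the operator acts on `r` as its diagonal entry, up to lower
degrees orthogonal to `r`. -/
theorem norm_sq_polyL2_derivative_add {n : ℕ} {p r : ℂ[X]} (hp : p ∈ degreeLT ℂ n)
    (hr : r ∈ degreeLT ℂ (n + 1))
    (hpr : ∀ q ∈ degreeLT ℂ n, inner ℂ (MMGF.polyL2 hα q) (MMGF.polyL2 hα r) = 0) :
    ‖MMGF.polyL2 hα' (derivative (p + r))‖ ^ 2 = ‖MMGF.polyL2 hα' (derivative p)‖ ^ 2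
      + n * (n + 2 * α - 2) * ‖MMGF.polyL2 hα r‖ ^ 2 := by
  have e1 : inner ℂ (MMGF.polyL2 hα' (derivative p)) (MMGF.polyL2 hα' (derivative r)) = 0 := by
    rw [polyL2 hα hα' r]
    exact hpr _ (adjDeriv_derivative_mem_degreeLT α hp)
  have e2 : inner ℂ (MMGF.polyL2 hα' (derivative r)) (MMGF.polyL2 hα' (derivative r))
      = ((n * (n + 2 * α - 2) : ℝ) : ℂ) * inner ℂ (MMGF.polyL2 hα r) (MMGF.polyL2 hα r) := by
    rw [polyL2 hα hα' r]
    have := hpr _ (adjDeriv_derivative_sub_mem_degreeLT α hr)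
    rw [map_sub, map_smul, inner_sub_left, inner_smul_left, Complex.conj_ofReal] at this
    exact sub_eq_zero.1 this
  have e3 : ‖MMGF.polyL2 hα' (derivative r)‖ ^ 2
      = n * (n + 2 * α - 2) * ‖MMGF.polyL2 hα r‖ ^ 2 := by
    have e4 := congrArg Complex.re e2
    have hn : ∀ v : L2, (inner ℂ v v).re = ‖v‖ ^ 2 := fun v => inner_self_eq_norm_sq (𝕜 := ℂ) v
    rwa [Complex.re_ofReal_mul, hn, hn] at e4
  rw [map_add, map_add, @norm_add_sq ℂ, e1, e3]
  simp

/-- The Poincaré inequality for functions orthogonal to the polynomials of degree less than `n`. -/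
theorem poincare (h : IsPolyDeriv hα hα' f g) {n : ℕ}
    (hf : ∀ q ∈ degreeLT ℂ n, inner ℂ (MMGF.polyL2 hα q) f = 0) :
    n * (n + 2 * α - 2) * ‖f‖ ^ 2 ≤ ‖g‖ ^ 2 := by
  -- Induction on the degree bound `M` replaces an eigenfunction expansion: each new degree adds an
  -- orthogonal piece whose derivative is large enough. Letting `M` tend to infinity uses density
  -- and the bound of `‖p'‖` by `‖g‖`.
  have step : ∀ M, n ≤ M → ∃ p ∈ degreeLT ℂ M,
      MMGF.polyL2 hα p = (polySpace hα M).starProjection f ∧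
      n * (n + 2 * α - 2) * ‖(polySpace hα M).starProjection f‖ ^ 2
        ≤ ‖MMGF.polyL2 hα' (derivative p)‖ ^ 2 := by
    intro M hM
    induction M, hM using Nat.le_induction with
    | base =>
      have h0 : (polySpace hα n).starProjection f = 0 := by
        rw [Submodule.starProjection_apply_eq_zero_iff]
        rintro _ ⟨q, hq, rfl⟩
        exact hf q hq
      exact ⟨0, zero_mem _, by rw [h0, map_zero], by simp [h0]⟩
    | succ M hM ih =>
      obtain ⟨p, hp, hpf, hle⟩ := ih
      obtain ⟨s, hs, hsf⟩ := Submodule.starProjection_apply_mem (polySpace hα (M + 1)) f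
      have hr : s - p ∈ degreeLT ℂ (M + 1) := sub_mem hs (degreeLT_mono M.le_succ hp)
      have hpr : ∀ q ∈ degreeLT ℂ M,
          inner ℂ (MMGF.polyL2 hα q) (MMGF.polyL2 hα (s - p)) = 0 := fun q hq => by
        have hq' := polyL2_mem_polySpace hα hq
        rw [map_sub, hsf, hpf, inner_sub_right, ← Submodule.inner_starProjection_left_eq_right,
          ← Submodule.inner_starProjection_left_eq_right,
          Submodule.starProjection_eq_self_iff.2 hq',
          Submodule.starProjection_eq_self_iff.2 (polySpace_mono hα M.le_succ hq'), sub_self]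
      refine ⟨s, hs, hsf, ?_⟩
      have e1 := norm_sq_polyL2_derivative_add (hα' := hα') hp hr hpr
      have e2 : ‖MMGF.polyL2 hα s‖ ^ 2
          = ‖MMGF.polyL2 hα p‖ ^ 2 + ‖MMGF.polyL2 hα (s - p)‖ ^ 2 := by
        rw [← add_sub_cancel p s, map_add, @norm_add_sq ℂ, add_sub_cancel_left, hpr p hp]
        simp
      rw [add_sub_cancel] at e1
      rw [← hsf, e2, e1]
      rw [← hpf] at hle
      -- The difference is `(M - n) (M + n + 2α - 2)`, whose second factor is positive once `M ≥ n +
      -- 1`, because `2α > 1`.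
      have hμ : (n : ℝ) * (n + 2 * α - 2) ≤ M * (M + 2 * α - 2) := by
        rcases hM.eq_or_lt with rfl | hlt
        · rfl
        · have h1 : (n : ℝ) + 1 ≤ M := by exact_mod_cast hlt
          have h2 : (0 : ℝ) ≤ n := n.cast_nonneg
          nlinarith
      nlinarith [sq_nonneg ‖MMGF.polyL2 hα (s - p)‖]
  have hlim := ((tendsto_starProjection_polySpace hα f).norm.pow 2).const_mul
    ((n : ℝ) * (n + 2 * α - 2))
  refine le_of_tendsto hlim (eventually_atTop.2 ⟨n, fun M hM => ?_⟩)
  obtain ⟨p, hp, hpf, hle⟩ := step M hM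
  exact hle.trans (pow_le_pow_left₀ (norm_nonneg _) (h.norm_polyL2_derivative_le hp hpf) 2)

end IsPolyDeriv

end

/-! ### The Fourier transform and interpolation between `L²` and `H¹`. -/

theorem integral_schwartz_mul_fourier (Φ : SchwartzMap ℝ ℂ) (u : L2) :
    ∫ x, Φ x * (𝓕 u : L2) x = ∫ x, (𝓕 Φ) x * u x := by
  have h := congrArg (fun T : TemperedDistribution ℝ ℂ => T Φ)
    (Lp.fourier_toTemperedDistribution_eq (E := ℝ) (F := ℂ) u)
  simp only [TemperedDistribution.fourier_apply, Lp.toTemperedDistribution_apply,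
    smul_eq_mul] at h
  exact h.symm

/-- The Fourier transform of a weak derivative. -/
theorem IsWeakDeriv.fourier_ae_eq {v g : L2} (h : IsWeakDeriv v g) :
    (𝓕 g : L2) =ᵐ[volume] fun x => 2 * Real.pi * Complex.I * x * (𝓕 v : L2) x := by
  have hloc : ∀ u : L2, LocallyIntegrable u := fun u => (Lp.memLp u).locallyIntegrable one_le_two
  have hc : Continuous fun x : ℝ => 2 * Real.pi * Complex.I * (x : ℂ) := by fun_prop
  have hloc' : LocallyIntegrable fun x => 2 * Real.pi * Complex.I * x * (𝓕 v : L2) x :=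
    ((hloc (𝓕 v)).mul_continuous hc).congr (.of_forall fun x => by simp [mul_comm])
  have key : ∀ᵐ x : ℝ, (𝓕 g : L2) x - 2 * Real.pi * Complex.I * x * (𝓕 v : L2) x = 0 := by
    refine ae_eq_zero_of_integral_contDiff_smul_eq_zero ((hloc (𝓕 g)).sub hloc')
      fun ψ hψ hψc => ?_
    have c1 : HasCompactSupport fun x => (ψ x : ℂ) := hψc.comp_left Complex.ofReal_zero
    have s1 : ContDiff ℝ ∞ fun x => (ψ x : ℂ) := Complex.ofRealCLM.contDiff.comp hψ
    have c2 : HasCompactSupport fun x : ℝ => (-2 * Real.pi * Complex.I * x) • (ψ x : ℂ) :=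
      c1.smul_left (f := fun x : ℝ => -2 * Real.pi * Complex.I * (x : ℂ))
    have s2 : ContDiff ℝ ∞ fun x : ℝ => (-2 * Real.pi * Complex.I * x) • (ψ x : ℂ) :=
      (contDiff_const.mul Complex.ofRealCLM.contDiff).smul s1
    let Ψ : SchwartzMap ℝ ℂ := c1.toSchwartzMap s1
    let Ψ' : SchwartzMap ℝ ℂ := c2.toSchwartzMap s2
    have hΨ : ∀ x, Ψ x = ψ x := fun x => rfl
    have hΨ' : ∀ x, Ψ' x = (-2 * Real.pi * Complex.I * x) • (ψ x : ℂ) := fun x => rfl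
    have hd : ∀ x, HasDerivAt (𝓕 Ψ : SchwartzMap ℝ ℂ) ((𝓕 Ψ' : SchwartzMap ℝ ℂ) x) x := fun x => by
      have h1 : HasDerivAt (𝓕 Ψ : SchwartzMap ℝ ℂ) (deriv (𝓕 Ψ : SchwartzMap ℝ ℂ) x) x :=
        (SchwartzMap.differentiable _ x).hasDerivAt
      have hi : Integrable fun x : ℝ => x • Ψ x :=
        (continuous_id.smul Ψ.continuous).integrable_of_hasCompactSupport
          (c1.smul_left (f := fun x : ℝ => x))
      have h2 : deriv (𝓕 Ψ : SchwartzMap ℝ ℂ) = (𝓕 Ψ' : SchwartzMap ℝ ℂ) :=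
        Real.deriv_fourier Ψ.integrable hi
      rwa [h2] at h1
    have hL : ∀ (u : L2) (Φ : SchwartzMap ℝ ℂ), Integrable fun x => u x * Φ x := fun u Φ =>
      (Lp.memLp u).integrable_mul (Φ.memLp 2)
    -- The test function is the Fourier transform of `Ψ`, which need not have compact support; hence
    -- the extended integration by parts.
    have key := h.integral_eq (SchwartzMap.smooth _ _) hd (hL v _) (hL g _) <| by
      refine (hL v (𝓕 Ψ)).mul_bdd (c := 1) (Complex.continuous_ofReal.comp
        (continuous_one_add_sq_rpow _)).aestronglyMeasurable (.of_forall fun x => ?_)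
      rw [Complex.norm_real, Real.norm_of_nonneg (Real.rpow_nonneg (one_add_sq_pos x).le _)]
      exact Real.rpow_le_one_of_one_le_of_nonpos (one_le_one_add_sq x) (by norm_num)
    simp only [mul_comm (v _), mul_comm (g _)] at key
    rw [← integral_schwartz_mul_fourier, ← integral_schwartz_mul_fourier] at key
    have i1 : Integrable fun x => Ψ x * (𝓕 g : L2) x := by
      simpa only [mul_comm] using hL (𝓕 g) Ψ
    have i2 : Integrable fun x => Ψ' x * (𝓕 v : L2) x := by
      simpa only [mul_comm] using hL (𝓕 v) Ψ'
    calc ∫ x, ψ x • ((𝓕 g : L2) x - 2 * Real.pi * Complex.I * x * (𝓕 v : L2) x)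
        = ∫ x, (Ψ x * (𝓕 g : L2) x + Ψ' x * (𝓕 v : L2) x) :=
          integral_congr_ae (.of_forall fun x => by
            simp only [hΨ, hΨ', Complex.real_smul, smul_eq_mul]
            ring)
      _ = 0 := by rw [integral_add i1 i2, key, add_neg_cancel]
  filter_upwards [key] with x hx using sub_eq_zero.1 hx

theorem lintegral_enorm_sq (u : L2) : ∫⁻ x, ‖u x‖ₑ ^ 2 = ENNReal.ofReal (‖u‖ ^ 2) := by
  rw [Lp.norm_def, ← ENNReal.toReal_pow, ENNReal.ofReal_toReal (by finiteness),
    eLpNorm_eq_lintegral_rpow_enorm_toReal (by norm_num) (by norm_num), ← ENNReal.rpow_natCast,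
    ← ENNReal.rpow_mul]
  simp

theorem lintegral_comp_div {c : ℝ} (hc : 0 < c) {F : ℝ → ℝ≥0∞} (hF : Measurable F) :
    ∫⁻ x, F (x / c) = ENNReal.ofReal c * ∫⁻ x, F x := by
  have h := Real.map_volume_mul_left (a := c⁻¹) (inv_pos.2 hc).ne'
  rw [inv_inv, abs_of_pos hc] at h
  rw [← smul_eq_mul, ← lintegral_smul_measure, ← h, lintegral_map hF (by fun_prop)]
  simp only [div_eq_inv_mul]

/-- Substitute `ξ = 2πx`: the Jacobian `2π` cancels the squared normalising factor `1 / (2π)`. -/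
theorem lintegral_mul_enorm_fourierUnitary_sq (u : L2) {w : ℝ → ℝ≥0∞} (hw : Measurable w) :
    ∫⁻ ξ, w ξ * ‖fourierUnitary u ξ‖ₑ ^ 2
      = ∫⁻ x, w (2 * Real.pi * x) * ‖(𝓕 u : L2) x‖ₑ ^ 2 := by
  have hpi : 0 < 2 * Real.pi := by positivity
  have hm : Measurable fun x => w (2 * Real.pi * x) * ‖(𝓕 u : L2) x‖ₑ ^ 2 :=
    (hw.comp (by fun_prop)).mul
      ((Lp.stronglyMeasurable (𝓕 u : L2)).measurable.enorm.pow_const 2)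
  have hE : ENNReal.ofReal (2 * Real.pi) * ENNReal.ofReal (2 * Real.pi)⁻¹ = 1 := by
    rw [← ENNReal.ofReal_mul hpi.le, mul_inv_cancel₀ hpi.ne', ENNReal.ofReal_one]
  have e : ∀ ξ, w ξ * ‖fourierUnitary u ξ‖ₑ ^ 2 = ENNReal.ofReal (2 * Real.pi)⁻¹ *
      (fun x => w (2 * Real.pi * x) * ‖(𝓕 u : L2) x‖ₑ ^ 2) (ξ / (2 * Real.pi)) := fun ξ => by
    have h1 : ‖((1 / √(2 * Real.pi) : ℝ) : ℂ)‖ₑ ^ 2 = ENNReal.ofReal (2 * Real.pi)⁻¹ := by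
      rw [← ofReal_norm, Complex.norm_real, ← ENNReal.ofReal_pow (norm_nonneg _),
        Real.norm_eq_abs, sq_abs, div_pow, Real.sq_sqrt hpi.le, one_pow, one_div]
    dsimp only
    rw [fourierUnitary, enorm_mul, mul_pow, h1, mul_div_cancel₀ _ hpi.ne']
    ring
  rw [lintegral_congr e, lintegral_const_mul' _ _ ENNReal.ofReal_ne_top,
    lintegral_comp_div hpi hm, ← mul_assoc,
    mul_comm (ENNReal.ofReal _), hE, one_mul]

/-- With `y = (1 + ξ²) / N²` this is `y^s ≤ 1 + y`. Scaling by `N` balances the `L²` error against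
the error of the derivative, which is larger by a factor of order `N`. -/
theorem one_add_sq_rpow_le {s N : ℝ} (hs0 : 0 ≤ s) (hs1 : s ≤ 1) (hN : 0 < N) (ξ : ℝ) :
    (1 + |ξ| ^ 2) ^ s ≤ N ^ (2 * s) * (1 + N⁻¹ ^ 2) + N ^ (2 * s) * N⁻¹ ^ 2 * ξ ^ 2 := by
  have hy : 0 ≤ (1 + ξ ^ 2) / N ^ 2 := by positivity
  have h1 : ((1 + ξ ^ 2) / N ^ 2) ^ s ≤ 1 + (1 + ξ ^ 2) / N ^ 2 := by
    rcases le_total ((1 + ξ ^ 2) / N ^ 2) 1 with h | h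
    · linarith [Real.rpow_le_one hy h hs0]
    · linarith [Real.rpow_le_self_of_one_le h hs1]
  have h2 : (1 + |ξ| ^ 2) ^ s = N ^ (2 * s) * ((1 + ξ ^ 2) / N ^ 2) ^ s := by
    rw [Real.rpow_mul hN.le, ← Real.mul_rpow (by positivity) hy, Real.rpow_two, sq_abs,
      mul_div_cancel₀ _ (by positivity)]
  rw [h2]
  refine (mul_le_mul_of_nonneg_left h1 (by positivity)).trans (le_of_eq ?_)
  field_simp
  ring

/-- Interpolation between `L²(ℝ)` and `H¹(ℝ)`. -/
theorem IsWeakDeriv.sobolevNorm_sq_le {v g : L2} (h : IsWeakDeriv v g) {s N : ℝ} (hs0 : 0 ≤ s)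
    (hs1 : s ≤ 1) (hN : 0 < N) :
    sobolevNorm s v ^ 2 ≤ ENNReal.ofReal
      (N ^ (2 * s) * ((1 + N⁻¹ ^ 2) * ‖v‖ ^ 2 + N⁻¹ ^ 2 * ‖g‖ ^ 2)) := by
  have hA : ∫⁻ ξ, ‖fourierUnitary v ξ‖ₑ ^ 2 = ENNReal.ofReal (‖v‖ ^ 2) := by
    have := lintegral_mul_enorm_fourierUnitary_sq v (w := fun _ => 1) measurable_const
    simp only [one_mul] at this
    rw [this, lintegral_enorm_sq, Lp.norm_fourier_eq]
  have hB : ∫⁻ ξ, ENNReal.ofReal (ξ ^ 2) * ‖fourierUnitary v ξ‖ₑ ^ 2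
      = ENNReal.ofReal (‖g‖ ^ 2) := by
    rw [lintegral_mul_enorm_fourierUnitary_sq v (w := fun ξ => ENNReal.ofReal (ξ ^ 2))
      (by fun_prop), ← Lp.norm_fourier_eq g, ← lintegral_enorm_sq]
    refine lintegral_congr_ae ?_
    filter_upwards [h.fourier_ae_eq] with x hx
    rw [hx, enorm_mul, mul_pow (‖_‖ₑ)]
    congr 1
    rw [← ofReal_norm, ← ENNReal.ofReal_pow (norm_nonneg _)]
    congr 1
    simp [mul_pow]
  have hm : Measurable fun ξ => ‖fourierUnitary v ξ‖ₑ ^ 2 := by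
    refine (Measurable.enorm ?_).pow_const 2
    exact measurable_const.mul
      ((Lp.stronglyMeasurable (𝓕 v : L2)).measurable.comp (by fun_prop))
  have hm' : Measurable fun ξ => ENNReal.ofReal (ξ ^ 2) * ‖fourierUnitary v ξ‖ₑ ^ 2 :=
    Measurable.mul (by fun_prop) hm
  have hpow : sobolevNorm s v ^ 2
      = ∫⁻ ξ : ℝ, ENNReal.ofReal ((1 + |ξ| ^ 2) ^ s) * ‖fourierUnitary v ξ‖ₑ ^ 2 := by
    rw [sobolevNorm, ← ENNReal.rpow_natCast, ← ENNReal.rpow_mul]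
    simp
  have ha : 0 ≤ N ^ (2 * s) * (1 + N⁻¹ ^ 2) := by positivity
  have hb : 0 ≤ N ^ (2 * s) * N⁻¹ ^ 2 := by positivity
  rw [hpow]
  calc _ ≤ ∫⁻ ξ : ℝ, (ENNReal.ofReal (N ^ (2 * s) * (1 + N⁻¹ ^ 2)) * ‖fourierUnitary v ξ‖ₑ ^ 2
        + ENNReal.ofReal (N ^ (2 * s) * N⁻¹ ^ 2) *
          (ENNReal.ofReal (ξ ^ 2) * ‖fourierUnitary v ξ‖ₑ ^ 2)) := by
        refine lintegral_mono fun ξ => ?_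
        rw [← mul_assoc, ← ENNReal.ofReal_mul hb, ← add_mul,
          ← ENNReal.ofReal_add ha (by positivity)]
        gcongr
        exact one_add_sq_rpow_le hs0 hs1 hN ξ
    _ = _ := by
        rw [lintegral_add_left (hm.const_mul _), lintegral_const_mul _ hm,
          lintegral_const_mul _ hm', hA, hB, ← ENNReal.ofReal_mul ha,
          ← ENNReal.ofReal_mul hb, ← ENNReal.ofReal_add (by positivity) (by positivity)]
        congr 1
        ring

/-! ### Gegenbauer polynomials as a basis of the polynomials. -/

theorem degree_gegenbauerRec {lam : ℝ} (hlam : -1 / 2 < lam) (h0 : lam ≠ 0) (n : ℕ) :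
    (gegenbauerRec lam n).degree = n := by
  induction n using Nat.twoStepInduction with
  | zero => simp [gegenbauerRec]
  | one =>
    rw [gegenbauerRec, Polynomial.degree_C_mul (by simpa using h0), Polynomial.degree_X]
    rfl
  | more n h1 h2 =>
    have hc : 2 * ((n : ℝ) + 2 + lam - 1) ≠ 0 := by
      have : (0 : ℝ) ≤ n := n.cast_nonneg
      linarith
    have e : (Polynomial.C (2 * ((n : ℝ) + 2 + lam - 1)) * Polynomial.X *
        gegenbauerRec lam (n + 1)).degree = ((n + 2 : ℕ) : WithBot ℕ) := by
      rw [mul_assoc, Polynomial.degree_C_mul hc, Polynomial.degree_mul, Polynomial.degree_X, h2]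
      norm_cast
      omega
    rw [gegenbauerRec, Polynomial.degree_C_mul (by positivity),
      Polynomial.degree_sub_eq_left_of_degree_lt, e]
    rw [e]
    refine (Polynomial.degree_mul_le _ _).trans_lt ?_
    refine (add_le_add_left Polynomial.degree_C_le _).trans_lt ?_
    rw [h1, zero_add]
    norm_cast
    omega

theorem degree_gegenbauer {lam : ℝ} (hlam : -1 / 2 < lam) (n : ℕ) :
    (gegenbauer lam n).degree = n := by
  unfold gegenbauer
  split_ifs with h
  · simp
  · exact degree_gegenbauerRec hlam h n

/-- The complex Gegenbauer polynomials as a polynomial sequence. -/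
def gegenbauerSequence {lam : ℝ} (hlam : -1 / 2 < lam) : Polynomial.Sequence ℂ where
  elems' n := (gegenbauer lam n).map Complex.ofRealHom
  degree_eq' n := by rw [Polynomial.degree_map, degree_gegenbauer hlam]

theorem mmgfL2_eq_polyL2 {lam : ℝ} (hlam : -1 / 2 < lam) (hα : 1 / 2 < lam + 1) (n : ℕ) :
    mmgfL2 hlam n = polyL2 hα ((gegenbauer lam n).map Complex.ofRealHom) := by
  refine MemLp.toLp_congr (memLp_mmgf hlam n) (memLp_polyFun hα _) (.of_forall fun x => ?_)
  simp only [mmgf]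
  rw [polyFun, Polynomial.eval_map, show (mapT x : ℂ) = Complex.ofRealHom (mapT x) from rfl,
    Polynomial.eval₂_at_apply, Complex.ofRealHom_eq_coe, Complex.ofReal_mul]
  rfl

/-- Polynomials of exact degrees `0, …, N` span all polynomials of degree at most `N`. Nothing else
about the Gegenbauer polynomials enters the estimate. -/
theorem approxSpace_eq_polySpace {lam : ℝ} (hlam : -1 / 2 < lam) (hα : 1 / 2 < lam + 1) (N : ℕ) :
    approxSpace hlam N = polySpace hα (N + 1) := by
  rw [approxSpace, polySpace, ← (gegenbauerSequence hlam).span_degreeLT fun i _ =>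
    (Polynomial.leadingCoeff_ne_zero.2 ((gegenbauerSequence hlam).ne_zero i)).isUnit,
    Submodule.map_span]
  congr 1
  ext f
  simp only [Set.mem_range, Set.mem_image, Set.mem_Iio, exists_exists_and_eq_and]
  constructor
  · rintro ⟨i, rfl⟩
    exact ⟨i, i.2, (mmgfL2_eq_polyL2 hlam hα i).symm⟩
  · rintro ⟨i, hi, rfl⟩
    exact ⟨⟨i, hi⟩, mmgfL2_eq_polyL2 hlam hα i⟩

/-! ### Iteration along the chain of derivatives. -/

/-- `(1 + x²)^{-α/2} f`. -/
def weighted (α : ℝ) (f : ℝ → ℂ) (x : ℝ) : ℂ := (((1 + x ^ 2) ^ (-(α / 2)) : ℝ) : ℂ) * f x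

/-- `D 0, …, D m` are successive weak derivatives with respect to `t`. -/
def IsMappedChain (m : ℕ) (D : ℕ → ℝ → ℂ) : Prop :=
  ∀ k < m, IsWeakDeriv (D k) fun x => (((1 + x ^ 2) ^ (-(3 / 2) : ℝ) : ℝ) : ℂ) * D (k + 1) x

theorem IsMappedChain.tail {m : ℕ} {D : ℕ → ℝ → ℂ} (h : IsMappedChain (m + 1) D) :
    IsMappedChain m fun k => D (k + 1) := fun k hk => h (k + 1) (by omega)

/-- The seminorm controls only the top derivative; descending by the Hardy argument recovers the
weighted integrability of the lower ones. -/
theorem IsMappedChain.memLp {m : ℕ} {α β : ℝ} (hα : 1 / 2 < α) (hβ : β = α + m)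
    {D : ℕ → ℝ → ℂ} (h : IsMappedChain m D) (hD : MemLp (weighted β (D m)) 2 volume) :
    MemLp (weighted α (D 0)) 2 volume := by
  induction m generalizing α D with
  | zero => simpa [hβ] using hD
  | succ m ih =>
    exact (h 0 (by omega)).memLp_weighted hα
      (ih (α := α + 1) (by linarith) (by rw [hβ]; push_cast; ring) h.tail hD)

theorem pow_succ_mul_le {κ μ a b c : ℝ} {m : ℕ} (hκ : 0 ≤ κ) (h : κ ≤ μ) (hab : μ * a ^ 2 ≤ b ^ 2)
    (hbc : κ ^ m * b ^ 2 ≤ c ^ 2) : κ ^ (m + 1) * a ^ 2 ≤ c ^ 2 :=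
  calc κ ^ (m + 1) * a ^ 2 = κ ^ m * (κ * a ^ 2) := by ring
    _ ≤ κ ^ m * (μ * a ^ 2) := by gcongr
    _ ≤ κ ^ m * b ^ 2 := by gcongr
    _ ≤ c ^ 2 := hbc

/-- The estimate for the weighted best approximation of the highest derivative. -/
theorem IsMappedChain.pow_mul_norm_sq_le {m n : ℕ} {α β L R : ℝ} (hα : 1 / 2 < α)
    (hβ : β = α + m) {D : ℕ → ℝ → ℂ} (h : IsMappedChain m D)
    (hD : MemLp (weighted β (D m)) 2 volume) (hD0 : MemLp (weighted α (D 0)) 2 volume)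
    (hL0 : 0 ≤ L) (hR0 : 0 ≤ R) (hL : L ≤ n + 2 * α - 2) (hR : R ≤ n - m + 1)
    {p : Polynomial ℂ} (hp : p ∈ Polynomial.degreeLT ℂ n)
    (hf : ∀ q ∈ Polynomial.degreeLT ℂ n, inner ℂ (polyL2 hα q) ((hD0.toLp : L2) - polyL2 hα p) = 0) :
    (R * L) ^ m * ‖(hD0.toLp : L2) - polyL2 hα p‖ ^ 2 ≤ ‖(hD.toLp : L2)‖ ^ 2 := by
  induction m generalizing α D n p with
  | zero =>
    have hβ' : β = α := by simpa using hβ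
    subst hβ'
    have e : ‖(hD.toLp : L2)‖ ^ 2 = ‖polyL2 hα p‖ ^ 2 + ‖(hD0.toLp : L2) - polyL2 hα p‖ ^ 2 := by
      conv_lhs => rw [← add_sub_cancel (polyL2 hα p) (hD.toLp : L2), @norm_add_sq ℂ, hf p hp]
      simp
    rw [pow_zero, one_mul, e]
    exact le_add_of_nonneg_left (by positivity)
  | succ m ih =>
    have hα' : 1 / 2 < α + 1 := by linarith
    have hβ' : β = α + 1 + m := by rw [hβ]; push_cast; ring
    have hD1 : MemLp (weighted (α + 1) (D 1)) 2 volume := h.tail.memLp hα' hβ' hD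
    have hder : IsPolyDeriv hα hα' (hD0.toLp : L2) (hD1.toLp : L2) :=
      (h 0 (by omega)).inner_polyL2_eq hα hα' hD0 hD1
    have hder' := hder.sub (IsPolyDeriv.polyL2 hα hα' p)
    push_cast at hR
    rcases n with _ | n
    -- For `n = 0` there is no degree left to lower, but then `R ≤ -m` forces `R = 0` and the left
    -- side vanishes.
    · have hR' : R = 0 := by
        have : (0 : ℝ) ≤ m := m.cast_nonneg
        push_cast at hR
        linarith
      rw [hR', zero_mul, zero_pow (by omega), zero_mul]
      positivity
    have hP := hder'.poincare hf
    push_cast at hP hR hL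
    -- Passing to the derivative lowers `n` and `m` by one and raises `α` by one. So `n - m + 1` is
    -- unchanged and `n + 2α - 2` grows, and the same `L` and `R` serve throughout.
    have hih := ih (n := n) hα' hβ' h.tail hD hD1 (by linarith) (by linarith)
      (derivative_mem_degreeLT hp) (hder'.inner_eq_zero hf)
    have h1 : R * L ≤ ((n : ℝ) + 1) * ((n : ℝ) + 1 + 2 * α - 2) := by
      have : (0 : ℝ) ≤ m := m.cast_nonneg
      exact mul_le_mul (by linarith) hL hL0 (by positivity)
    exact pow_succ_mul_le (mul_nonneg hR0 hL0) h1 hP hih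

/-! ### From derivatives in `t` to derivatives in `x`. -/

theorem IsWeakDeriv.congr_right {f g g₂ : ℝ → ℂ} (h : IsWeakDeriv f g) (hg : g =ᵐ[volume] g₂) :
    IsWeakDeriv f g₂ := by
  refine ⟨h.1, h.2.1.congr hg, fun φ hφ hc => ?_⟩
  rw [h.2.2 φ hφ hc]
  congr 1
  exact integral_congr_ae (hg.mono fun x hx => by simp only [hx])

theorem IsWeakDeriv.neg {f g : ℝ → ℂ} (h : IsWeakDeriv f g) :
    IsWeakDeriv (fun x => -f x) fun x => -g x := by
  refine ⟨h.1.neg, h.2.1.neg, fun φ hφ hc => ?_⟩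
  simp only [neg_mul, integral_neg]
  rw [h.2.2 φ hφ hc]

/-- A weight of order one in the derivative bounds the derivative of the weighted function. -/
theorem IsWeakDeriv.exists_weighted {α : ℝ} (hα : 0 ≤ α) {E E' : ℝ → ℂ}
    (h : IsWeakDeriv E fun x => (((1 + x ^ 2) ^ (-(3 / 2) : ℝ) : ℝ) : ℂ) * E' x)
    (hE : MemLp (weighted α E) 2 volume) (hE' : MemLp (weighted (α + 1) E') 2 volume) :
    ∃ g : L2, IsWeakDeriv (hE.toLp : L2) g ∧ ‖g‖ ≤ ‖(hE'.toLp : L2)‖ + α * ‖(hE.toLp : L2)‖ := by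
  have hc : Continuous fun x : ℝ => (1 + x ^ 2)⁻¹ :=
    (by fun_prop : Continuous fun x : ℝ => 1 + x ^ 2).inv₀ fun x => (one_add_sq_pos x).ne'
  have hc1 : Continuous fun x : ℝ => (((1 + x ^ 2)⁻¹ : ℝ) : ℂ) :=
    Complex.continuous_ofReal.comp hc
  have hc2 : Continuous fun x : ℝ => ((-α * x * (1 + x ^ 2)⁻¹ : ℝ) : ℂ) :=
    Complex.continuous_ofReal.comp ((continuous_const.mul continuous_id).mul hc)
  -- The product rule gives the weighted `E'` times `(1 + x²)⁻¹` plus the weighted `E` times `-α x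
  -- (1 + x²)⁻¹`. These multipliers are bounded by `1` and `α`.
  have b1 : ∀ x : ℝ, ‖(((1 + x ^ 2)⁻¹ : ℝ) : ℂ) * weighted (α + 1) E' x‖
      ≤ 1 * ‖weighted (α + 1) E' x‖ := fun x => by
    rw [norm_mul, Complex.norm_real, Real.norm_of_nonneg (inv_pos.2 (one_add_sq_pos x)).le]
    gcongr
    exact inv_le_one_of_one_le₀ (one_le_one_add_sq x)
  have b2 : ∀ x : ℝ, ‖((-α * x * (1 + x ^ 2)⁻¹ : ℝ) : ℂ) * weighted α E x‖
      ≤ α * ‖weighted α E x‖ := fun x => by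
    have hw := one_add_sq_pos x
    rw [norm_mul, Complex.norm_real]
    gcongr
    rw [Real.norm_eq_abs, abs_mul, abs_mul, abs_neg, abs_of_nonneg hα,
      abs_of_pos (inv_pos.2 hw), mul_assoc]
    refine mul_le_of_le_one_right hα ?_
    rw [← div_eq_mul_inv, div_le_one hw, ← sq_abs]
    nlinarith [sq_nonneg (|x| - 1), sq_nonneg |x|]
  have m1 := hE'.of_le_mul (hc1.aestronglyMeasurable.mul hE'.1) (.of_forall b1)
  have m2 := hE.of_le_mul (hc2.aestronglyMeasurable.mul hE.1) (.of_forall b2)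
  refine ⟨m1.toLp + m2.toLp, ?_, (norm_add_le _ _).trans (add_le_add ?_ ?_)⟩
  · refine ((h.mul (contDiff_one_add_sq_rpow (-(α / 2)))).congr_left
      hE.coeFn_toLp.symm).congr_right ?_
    filter_upwards [Lp.coeFn_add (m1.toLp : L2) (m2.toLp : L2), m1.coeFn_toLp, m2.coeFn_toLp]
      with x hx h1 h2
    have hw := one_add_sq_pos x
    rw [hx, Pi.add_apply, h1, h2, (hasDerivAt_one_add_sq_rpow _ x).deriv, ← mul_assoc]
    simp only [Pi.mul_apply, weighted]
    have e1 : (1 + x ^ 2) ^ (-(α / 2)) * (1 + x ^ 2) ^ (-(3 / 2) : ℝ)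
        = (1 + x ^ 2)⁻¹ * (1 + x ^ 2) ^ (-((α + 1) / 2)) := by
      rw [← Real.rpow_neg_one, ← Real.rpow_add hw, ← Real.rpow_add hw]
      ring_nf
    have e2 : 2 * -(α / 2) * x * (1 + x ^ 2) ^ (-(α / 2) - 1)
        = -α * x * (1 + x ^ 2)⁻¹ * (1 + x ^ 2) ^ (-(α / 2)) := by
      rw [Real.rpow_sub_one hw.ne']
      ring
    rw [← Complex.ofReal_mul, e1, e2]
    push_cast
    ring
  · rw [← one_mul ‖(hE'.toLp : L2)‖]
    refine Lp.norm_le_mul_norm_of_ae_le_mul ?_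
    filter_upwards [m1.coeFn_toLp, hE'.coeFn_toLp] with x h1 h2
    rw [h1, h2]
    exact b1 x
  · refine Lp.norm_le_mul_norm_of_ae_le_mul ?_
    filter_upwards [m2.coeFn_toLp, hE.coeFn_toLp] with x h1 h2
    rw [h1, h2]
    exact b2 x

/-! ### Constants and the final estimate. -/

theorem weightedNorm_mono {σ τ : ℝ} (h : σ ≤ τ) (f : ℝ → ℂ) :
    weightedNorm σ f ≤ weightedNorm τ f := by
  refine eLpNorm_mono fun x => ?_
  have hw := one_add_sq_pos x
  rw [norm_mul, norm_mul, Complex.norm_real, Complex.norm_real,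
    Real.norm_of_nonneg (Real.rpow_nonneg hw.le _), Real.norm_of_nonneg (Real.rpow_nonneg hw.le _)]
  gcongr
  exact one_le_one_add_sq x

theorem mappedSeminorm_mono {lam σ τ : ℝ} (h : σ ≤ τ) (m : ℕ) (u : ℝ → ℂ) :
    mappedSeminorm lam σ m u ≤ mappedSeminorm lam τ m u :=
  iInf₂_mono fun _ _ => weightedNorm_mono h _

/-- The constant in the approximation estimate. -/
def approxConst (lam : ℝ) (m : ℕ) : ℝ :=
  √((2 * m + 2 + 2 * (lam + 1) ^ 2 * m) * (m : ℝ) ^ (m - 1))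

theorem approxConst_pos (lam : ℝ) {m : ℕ} (hm : 1 ≤ m) : 0 < approxConst lam m := by
  have : (0 : ℝ) < m := by exact_mod_cast hm
  exact Real.sqrt_pos.2 (by positivity)

/-- The combination of the two error estimates, for `a` the error and `b` that of the
derivative. -/
theorem interpolation_bound {lam s N a b S : ℝ} {m : ℕ} (hm : 1 ≤ m) (hN : 1 ≤ N)
    (h1 : N / m * N * a ^ 2 ≤ b ^ 2) (h2 : (N / m * N) ^ (m - 1) * b ^ 2 ≤ S ^ 2) :
    N ^ (2 * s) * ((1 + N⁻¹ ^ 2) * a ^ 2 + N⁻¹ ^ 2 * (b + (lam + 1) * a) ^ 2)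
      ≤ (approxConst lam m * N ^ (s - m) * S) ^ 2 := by
  have hm0 : (0 : ℝ) < m := by exact_mod_cast hm
  have hN0 : 0 < N := by linarith
  have ha : a ^ 2 ≤ m * (N⁻¹ ^ 2 * b ^ 2) := by
    have : a ^ 2 ≤ b ^ 2 / (N / m * N) := by
      rw [le_div_iff₀ (by positivity)]
      linarith
    refine this.trans (le_of_eq ?_)
    field_simp
  have hb : b ^ 2 ≤ (m : ℝ) ^ (m - 1) * (N⁻¹ ^ 2) ^ (m - 1) * S ^ 2 := by
    have : b ^ 2 ≤ S ^ 2 / (N / m * N) ^ (m - 1) := by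
      rw [le_div_iff₀ (by positivity)]
      linarith
    refine this.trans (le_of_eq ?_)
    rw [show N / m * N = ((m : ℝ) * N⁻¹ ^ 2)⁻¹ by field_simp, inv_pow, div_inv_eq_mul, mul_pow]
    ring
  have hNi : N⁻¹ ^ 2 ≤ 1 := pow_le_one₀ (by positivity) (inv_le_one_of_one_le₀ hN)
  have hNi0 : 0 ≤ N⁻¹ ^ 2 := by positivity
  -- The first factor of the constant arises here: the left side is at most `2a² + 2N⁻²b² + 2(λ +
  -- 1)²a²`, and `a² ≤ m N⁻² b²`. The factor `m^(m-1)` comes from `hb`.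
  have hsum : (1 + N⁻¹ ^ 2) * a ^ 2 + N⁻¹ ^ 2 * (b + (lam + 1) * a) ^ 2
      ≤ (2 * m + 2 + 2 * (lam + 1) ^ 2 * m) * (N⁻¹ ^ 2 * b ^ 2) := by
    have e1 : (b + (lam + 1) * a) ^ 2 ≤ 2 * b ^ 2 + 2 * (lam + 1) ^ 2 * a ^ 2 := by
      nlinarith [sq_nonneg (b - (lam + 1) * a)]
    have e2 : N⁻¹ ^ 2 * (b + (lam + 1) * a) ^ 2
        ≤ 2 * (N⁻¹ ^ 2 * b ^ 2) + 2 * (lam + 1) ^ 2 * a ^ 2 := by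
      have h3 := mul_le_mul_of_nonneg_left e1 hNi0
      have h4 : N⁻¹ ^ 2 * (2 * (lam + 1) ^ 2 * a ^ 2) ≤ 1 * (2 * (lam + 1) ^ 2 * a ^ 2) :=
        mul_le_mul_of_nonneg_right hNi (by positivity)
      linarith
    have e3 : (1 + N⁻¹ ^ 2) * a ^ 2 ≤ 2 * a ^ 2 :=
      mul_le_mul_of_nonneg_right (by linarith) (sq_nonneg a)
    have e4 := mul_le_mul_of_nonneg_left ha
      (by positivity : (0 : ℝ) ≤ 2 + 2 * (lam + 1) ^ 2)
    linarith
  have hpow : N ^ (2 * s) * (N⁻¹ ^ 2 * (N⁻¹ ^ 2) ^ (m - 1)) = (N ^ (s - m)) ^ 2 := by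
    rw [← pow_succ', Nat.sub_add_cancel hm, ← pow_mul, inv_pow, ← Real.rpow_natCast N (2 * m),
      ← Real.rpow_neg hN0.le, ← Real.rpow_add hN0, ← Real.rpow_natCast (N ^ (s - m)) 2,
      ← Real.rpow_mul hN0.le]
    congr 1
    push_cast
    ring
  rw [mul_pow, mul_pow, approxConst, Real.sq_sqrt (by positivity), ← hpow]
  have hC : (0 : ℝ) ≤ 2 * m + 2 + 2 * (lam + 1) ^ 2 * m := by positivity
  calc _ ≤ N ^ (2 * s) * ((2 * m + 2 + 2 * (lam + 1) ^ 2 * m) * (N⁻¹ ^ 2 *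
        ((m : ℝ) ^ (m - 1) * (N⁻¹ ^ 2) ^ (m - 1) * S ^ 2))) :=
        mul_le_mul_of_nonneg_left (hsum.trans (by gcongr)) (by positivity)
    _ = _ := by ring

/-- The error of the projection, in `L²(ℝ)` and with its derivative. -/
theorem IsMappedChain.exists_error_bounds {lam : ℝ} (hlam : -1 / 2 < lam) {k N : ℕ} (hN : 1 ≤ N)
    (hkN : k ≤ N) {u : L2} {D : ℕ → ℝ → ℂ} (hchain : IsMappedChain (k + 1) D)
    {β : ℝ} (hβ : β = lam + 1 + (k + 1 : ℕ)) (hLp : MemLp (weighted β (D (k + 1))) 2 volume)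
    (hDu : D 0 =ᵐ[volume] fun x => (((1 + x ^ 2) ^ ((lam + 1) / 2) : ℝ) : ℂ) * u x) :
    ∃ (g : L2) (b : ℝ), IsWeakDeriv (proj hlam N u - u : L2) g ∧
      ‖g‖ ≤ b + (lam + 1) * ‖proj hlam N u - u‖ ∧
      (N : ℝ) / (k + 1 : ℕ) * N * ‖proj hlam N u - u‖ ^ 2 ≤ b ^ 2 ∧
      ((N : ℝ) / (k + 1 : ℕ) * N) ^ k * b ^ 2 ≤ ‖(hLp.toLp : L2)‖ ^ 2 := by
  have hN1 : (1 : ℝ) ≤ N := by exact_mod_cast hN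
  have hα : 1 / 2 < lam + 1 := by linarith
  have hα' : 1 / 2 < lam + 1 + 1 := by linarith
  have hβ2 : β = lam + 1 + 1 + k := by rw [hβ]; push_cast; ring
  have hD0 : MemLp (weighted (lam + 1) (D 0)) 2 volume := hchain.memLp hα hβ hLp
  have hD1 : MemLp (weighted (lam + 1 + 1) (D 1)) 2 volume := hchain.tail.memLp hα' hβ2 hLp
  have hu : (hD0.toLp : L2) = u := by
    refine Lp.ext ?_
    filter_upwards [hD0.coeFn_toLp, hDu] with x h1 h2
    rw [h1, weighted, h2, ← mul_assoc, ← Complex.ofReal_mul, ← Real.rpow_add (one_add_sq_pos x)]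
    simp
  obtain ⟨p, hp, hpu⟩ : ∃ p ∈ Polynomial.degreeLT ℂ (N + 1), polyL2 hα p = proj hlam N u := by
    have h1 : proj hlam N u ∈ approxSpace hlam N := Submodule.starProjection_apply_mem _ _
    rw [approxSpace_eq_polySpace hlam hα] at h1
    exact h1
  have horth : ∀ q ∈ Polynomial.degreeLT ℂ (N + 1),
      inner ℂ (polyL2 hα q) ((hD0.toLp : L2) - polyL2 hα p) = 0 := fun q hq => by
    have h1 : polyL2 hα q ∈ approxSpace hlam N := by
      rw [approxSpace_eq_polySpace hlam hα]
      exact polyL2_mem_polySpace hα hq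
    rw [hu, hpu]
    exact Submodule.inner_right_of_mem_orthogonal h1
      (Submodule.sub_starProjection_mem_orthogonal u)
  have hder : IsPolyDeriv hα hα' ((hD0.toLp : L2) - polyL2 hα p)
      ((hD1.toLp : L2) - polyL2 hα' (Polynomial.derivative p)) :=
    IsPolyDeriv.sub ((hchain 0 (by omega)).inner_polyL2_eq hα hα' hD0 hD1)
      (IsPolyDeriv.polyL2 hα hα' p)
  have hk0 : (0 : ℝ) ≤ k := k.cast_nonneg
  have hkN' : (k : ℝ) ≤ N := by exact_mod_cast hkN
  -- Since `(N - k + 1)(k + 1) - N = k (N - k) + 1`, the smallest degree factor is at least a fixed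
  -- fraction of `N`, even for `m = N + 1`.
  have hR : (N : ℝ) / (k + 1 : ℕ) ≤ N - k + 1 := by
    rw [div_le_iff₀ (by positivity)]
    push_cast
    nlinarith
  have hR0 : (0 : ℝ) ≤ (N : ℝ) / (k + 1 : ℕ) := by positivity
  have h1 : (N : ℝ) / (k + 1 : ℕ) * N * ‖(hD0.toLp : L2) - polyL2 hα p‖ ^ 2
      ≤ ‖(hD1.toLp : L2) - polyL2 hα' (Polynomial.derivative p)‖ ^ 2 := by
    have h := hder.poincare horth
    push_cast at h
    refine le_trans (mul_le_mul_of_nonneg_right ?_ (by positivity)) h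
    exact mul_le_mul (by linarith) (by linarith) (by linarith) (by positivity)
  have h2 : ((N : ℝ) / (k + 1 : ℕ) * N) ^ k *
      ‖(hD1.toLp : L2) - polyL2 hα' (Polynomial.derivative p)‖ ^ 2 ≤ ‖(hLp.toLp : L2)‖ ^ 2 :=
    hchain.tail.pow_mul_norm_sq_le (n := N) hα' hβ2 hLp hD1 (by linarith) hR0 (by linarith) hR
      (derivative_mem_degreeLT hp) (hder.inner_eq_zero horth)
  have hE : MemLp (weighted (lam + 1) fun x => D 0 x - p.eval (mapT x : ℂ)) 2 volume :=
    (hD0.sub (memLp_polyFun hα p)).ae_eq (.of_forall fun x => (mul_sub _ _ _).symm)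
  have hE' : MemLp (weighted (lam + 1 + 1) fun x => D 1 x -
      (Polynomial.derivative p).eval (mapT x : ℂ)) 2 volume :=
    (hD1.sub (memLp_polyFun hα' _)).ae_eq (.of_forall fun x => (mul_sub _ _ _).symm)
  have eE : (hE.toLp : L2) = (hD0.toLp : L2) - polyL2 hα p :=
    (MemLp.toLp_congr _ (hD0.sub (memLp_polyFun hα p)) (.of_forall fun x => mul_sub _ _ _)).trans
      (MemLp.toLp_sub hD0 (memLp_polyFun hα p))
  have eE' : (hE'.toLp : L2) = (hD1.toLp : L2) - polyL2 hα' (Polynomial.derivative p) :=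
    (MemLp.toLp_congr _ (hD1.sub (memLp_polyFun hα' _)) (.of_forall fun x => mul_sub _ _ _)).trans
      (MemLp.toLp_sub hD1 (memLp_polyFun hα' _))
  have hweak := ((hchain 0 (by omega)).sub (isWeakDeriv_eval_mapT p)).congr_right
    (g₂ := fun x => (((1 + x ^ 2) ^ (-(3 / 2) : ℝ) : ℝ) : ℂ) *
      (D 1 x - (Polynomial.derivative p).eval (mapT x : ℂ)))
    (.of_forall fun x => (mul_sub _ _ _).symm)
  obtain ⟨g, hg, hgn⟩ := hweak.exists_weighted (by linarith) hE hE'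
  rw [eE, eE'] at hgn
  have hneg : IsWeakDeriv (proj hlam N u - u : L2) (-g : L2) := by
    have e : proj hlam N u - u = -(hE.toLp : L2) := by rw [eE, hu, hpu, neg_sub]
    rw [e]
    exact (hg.neg.congr_left (Lp.coeFn_neg (hE.toLp : L2)).symm).congr_right (Lp.coeFn_neg g).symm
  have hnorm : ‖proj hlam N u - u‖ = ‖(hD0.toLp : L2) - polyL2 hα p‖ := by
    rw [hu, hpu, norm_sub_rev]
  refine ⟨-g, _, hneg, ?_, ?_, h2⟩
  · rw [norm_neg, hnorm]
    exact hgn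
  · rw [hnorm]
    exact h1

theorem sobolevNorm_proj_sub_le {lam : ℝ} (hlam : -1 / 2 < lam) {s : ℝ} (hs0 : 0 ≤ s)
    (hs1 : s ≤ 1) {m N : ℕ} (hm : 1 ≤ m) (hN : 1 ≤ N) (hmN : m ≤ N + 1) (u : L2)
    {D : ℕ → ℝ → ℂ} (hD : IsMappedDeriv lam m u D) :
    sobolevNorm s (proj hlam N u - u) ≤
      ENNReal.ofReal (approxConst lam m * (N : ℝ) ^ (s - m)) *
        weightedNorm (-((lam + m + 1) / 2)) (D m) := by
  obtain ⟨k, rfl⟩ : ∃ k, m = k + 1 := ⟨m - 1, by omega⟩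
  have hN1 : (1 : ℝ) ≤ N := by exact_mod_cast hN
  have hcpos : 0 < approxConst lam (k + 1) * (N : ℝ) ^ (s - (k + 1 : ℕ)) :=
    mul_pos (approxConst_pos lam hm) (Real.rpow_pos_of_pos (by linarith) _)
  -- An infinite norm makes the bound trivial because the constant is positive; a finite one puts
  -- the top derivative in weighted `L²`.
  rcases eq_or_ne (weightedNorm (-((lam + (k + 1 : ℕ) + 1) / 2)) (D (k + 1))) ⊤ with htop | htop
  · rw [htop, ENNReal.mul_top (ENNReal.ofReal_pos.2 hcpos).ne']
    exact le_top
  have hchain : IsMappedChain (k + 1) D := hD.2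
  set β := lam + (k + 1 : ℕ) + 1 with hβ
  have hDm : AEStronglyMeasurable (D (k + 1)) volume := by
    refine ((Complex.continuous_ofReal.comp (continuous_one_add_sq_rpow
      (3 / 2))).aestronglyMeasurable.mul (hD.2 k (by omega)).2.1.aestronglyMeasurable).congr
      (.of_forall fun x => ?_)
    simp only [Pi.mul_apply, Function.comp_apply]
    rw [← mul_assoc, ← Complex.ofReal_mul, ← Real.rpow_add (one_add_sq_pos x)]
    simp
  have hLp : MemLp (weighted β (D (k + 1))) 2 volume :=
    ⟨(Complex.continuous_ofReal.comp (continuous_one_add_sq_rpow _)).aestronglyMeasurable.mul hDm,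
      lt_top_iff_ne_top.2 htop⟩
  have hβ1 : β = lam + 1 + (k + 1 : ℕ) := by rw [hβ]; ring
  obtain ⟨g, b, hg, hgn, h1, h2⟩ :=
    hchain.exists_error_bounds hlam hN (by omega : k ≤ N) hβ1 hLp hD.1
  have hS : weightedNorm (-(β / 2)) (D (k + 1)) = ENNReal.ofReal ‖(hLp.toLp : L2)‖ := by
    rw [Lp.norm_toLp, ENNReal.ofReal_toReal hLp.2.ne]
    rfl
  rw [hS, ← ENNReal.ofReal_mul hcpos.le, ← ENNReal.pow_le_pow_left_iff two_ne_zero,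
    ← ENNReal.ofReal_pow (by positivity)]
  refine (hg.sobolevNorm_sq_le hs0 hs1 (N := N) (by linarith)).trans
    (ENNReal.ofReal_le_ofReal ?_)
  refine le_trans ?_ (interpolation_bound hm hN1 h1 h2)
  gcongr

end

end MMGF

theorem theorem4p1 (lam : ℝ) (hlam : -1 / 2 < lam) (s : ℝ) (hs0 : 0 < s) (hs1 : s < 1)
    (m : ℕ) (hm : 1 ≤ m) :
    ∃ c : ℝ, 0 < c ∧ ∀ N : ℕ, 1 ≤ N → m ≤ N + 1 → ∀ u : MMGF.L2, MMGF.MemSobolev s u →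
      (MMGF.MemMapped lam (-((lam + m + 1) / 2)) m u →
        MMGF.sobolevNorm s (MMGF.proj hlam N u - u) ≤
          ENNReal.ofReal (c * (N : ℝ) ^ (s - m)) *
            MMGF.mappedSeminorm lam (-((lam + m + 1) / 2)) m u) ∧
      (MMGF.MemMapped lam (1 / 4 - (lam + m) / 2) m u →
        MMGF.sobolevNorm s (MMGF.proj hlam N u - u) ≤
          ENNReal.ofReal (c * (N : ℝ) ^ (s - m)) *
            MMGF.mappedSeminorm lam (1 / 4 - (lam + m) / 2) m u) := by
  refine ⟨MMGF.approxConst lam m, MMGF.approxConst_pos lam hm, fun N hN hmN u _ => ?_⟩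
  have hc : 0 < MMGF.approxConst lam m * (N : ℝ) ^ (s - m) :=
    mul_pos (MMGF.approxConst_pos lam hm) (Real.rpow_pos_of_pos (by exact_mod_cast hN) _)
  have key : MMGF.sobolevNorm s (MMGF.proj hlam N u - u) ≤
      ENNReal.ofReal (MMGF.approxConst lam m * (N : ℝ) ^ (s - m)) *
        MMGF.mappedSeminorm lam (-((lam + m + 1) / 2)) m u := by
    -- The bound holds for every admissible `D`, so it passes to the infimum without using
    -- uniqueness of the derivatives.
    rw [MMGF.mappedSeminorm, ENNReal.mul_iInf_of_ne (ENNReal.ofReal_pos.2 hc).ne'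
      ENNReal.ofReal_ne_top]
    refine le_iInf fun D => ?_
    rw [ENNReal.mul_iInf_of_ne (ENNReal.ofReal_pos.2 hc).ne' ENNReal.ofReal_ne_top]
    exact le_iInf fun hD => MMGF.sobolevNorm_proj_sub_le hlam hs0.le hs1.le hm hN hmN u hD
  -- The second exponent exceeds the first by `3/4`, so its seminorm dominates and the same constant
  -- works.
  refine ⟨fun _ => key, fun _ => key.trans (mul_le_mul_right ?_ _)⟩
  exact MMGF.mappedSeminorm_mono (by linarith) m u
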